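/- Fix an integer $n \ge 2$ and a real number $1 < p < \infty$. For a unit vector $v \in \mathbb{R}^n$ and a Schwartz function $f : \mathbb{R}^n \to \mathbb{C}$ put $$\mathscr{H}_v f(x) = \frac{1}{\pi} \lim_{\varepsilon \to 0^+} \int_{|t| > \varepsilon} f(x - tv)\, \frac{dt}{t}, \qquad T_v f = (\chi_{\Gamma_v} \widehat f\,)^\vee, \qquad \Gamma_v = \{\xi \in \mathbb{R}^n : \xi \cdot v > 0\},$$ where $\widehat f(\xi) = \int f(x) e^{-2\pi i x \cdot \xi}\, dx$ and $g^\vee(x) = \int g(\xi) e^{2\pi i x \cdot \xi}\, d\xi$. For a nonempty finite set $U$ of unit vectors in $\mathbb{R}^n$ let $$\mathscr{H}_U f(x) = \max_{v \in U} |\mathscr{H}_v f(x)|, \qquad T_U f(x) = \max_{v \in U} |T_v f(x)|.$$ For such an operator $S$, let $\|S\|_{p \to p} \in [0, \infty]$ be its operator norm on $L^p(\mathbb{R}^n)$, that is, the least $K$ such that $\|S f\|_p \le K \|f\|_p$ for all Schwartz functions $f$. There is a constant $C_{p,n} > 0$, depending only on $p$ and $n$, such that for every nonempty finite set $U$ of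 unit vectors in $\mathbb{R}^n$, with $\# U$ its cardinality, $$\|\mathscr{H}_U\|_{p \to p} \ge C_{p,n} \sqrt{\log_2 \# U} \qquad\text{and}\qquad \|T_U\|_{p \to p} \ge C_{p,n} \sqrt{\log_2 \# U}.$$ -/

import Mathlib

open MeasureTheory Filter Topology SchwartzMap FourierTransform
open scoped NNReal ENNReal

namespace DirectionalHilbert

variable {n : ℕ}

/-- The truncated integral `∫_{|t| > ε} f (x - t v) dt / t`. -/
noncomputable def truncated (v : EuclideanSpace ℝ (Fin n)) (f : 𝓢(EuclideanSpace ℝ (Fin n), ℂ))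
    (x : EuclideanSpace ℝ (Fin n)) (ε : ℝ) : ℂ :=
  ∫ t in {t : ℝ | ε < |t|}, f (x - t • v) / (t : ℂ)

/-- The directional Hilbert transform
`H_v f (x) = (1/π) lim_{ε → 0⁺} ∫_{|t| > ε} f (x - t v) dt / t` of a Schwartz function `f`.
For a unit vector `v` the limit exists, see `tendsto_truncated`. -/
noncomputable def hilbert (v : EuclideanSpace ℝ (Fin n)) (f : 𝓢(EuclideanSpace ℝ (Fin n), ℂ))
    (x : EuclideanSpace ℝ (Fin n)) : ℂ :=
  (1 / (Real.pi : ℂ)) * limUnder (𝓝[>] (0 : ℝ)) (truncated v f x)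

/-- The open half-space `Γ_v = {ξ : ξ ⬝ v > 0}`. -/
def halfSpace (v : EuclideanSpace ℝ (Fin n)) : Set (EuclideanSpace ℝ (Fin n)) :=
  {ξ | 0 < inner ℝ ξ v}

/-- The half-space multiplier `T_v f = (χ_{Γ_v} f̂)^∨`, for the Fourier transform
`f̂ ξ = ∫ f x e^{-2πi x⬝ξ} dx` and its inverse `g^∨ x = ∫ g ξ e^{2πi x⬝ξ} dξ`. -/
noncomputable def halfSpaceMultiplier (v : EuclideanSpace ℝ (Fin n))
    (f : 𝓢(EuclideanSpace ℝ (Fin n), ℂ)) : EuclideanSpace ℝ (Fin n) → ℂ :=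
  𝓕⁻ ((halfSpace v).indicator (𝓕 (f : EuclideanSpace ℝ (Fin n) → ℂ)))

/-- The maximal operator `f ↦ max_{v ∈ U} |S_v f|` of a family of operators `S_v`, for a finite
set `U`. -/
noncomputable def maximal
    (S : EuclideanSpace ℝ (Fin n) → 𝓢(EuclideanSpace ℝ (Fin n), ℂ) →
      EuclideanSpace ℝ (Fin n) → ℂ)
    (U : Finset (EuclideanSpace ℝ (Fin n))) (f : 𝓢(EuclideanSpace ℝ (Fin n), ℂ))
    (x : EuclideanSpace ℝ (Fin n)) : ℝ :=
  ((U.sup fun v => ‖S v f x‖₊ : ℝ≥0) : ℝ)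

/-- The operator norm `‖T‖_{p → p} ∈ [0, ∞]` with respect to the norm of `L^p(ℝⁿ)` of an operator
that is defined on Schwartz functions: the least `K` with `‖T f‖_p ≤ K ‖f‖_p` for all Schwartz
functions `f`. -/
noncomputable def opNorm (p : ℝ)
    (T : 𝓢(EuclideanSpace ℝ (Fin n), ℂ) → EuclideanSpace ℝ (Fin n) → ℝ) : ℝ≥0∞ :=
  sInf {K : ℝ≥0∞ | ∀ f : 𝓢(EuclideanSpace ℝ (Fin n), ℂ),
    eLpNorm (T f) (ENNReal.ofReal p) volume ≤
      K * eLpNorm (f : EuclideanSpace ℝ (Fin n) → ℂ) (ENNReal.ofReal p) volume}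

/-- The restriction of a Schwartz function to a line is integrable. -/
theorem integrable_line (v : EuclideanSpace ℝ (Fin n)) (hv : ‖v‖ = 1)
    (f : 𝓢(EuclideanSpace ℝ (Fin n), ℂ)) (x : EuclideanSpace ℝ (Fin n)) :
    Integrable fun t : ℝ => f (x - t • v) := by
  have hg : Function.HasTemperateGrowth fun t : ℝ => x - t • v := by fun_prop
  have ha : AntilipschitzWith 1 fun t : ℝ => x - t • v := by
    refine AntilipschitzWith.of_le_mul_dist fun s t => ?_
    simp [dist_eq_norm, ← sub_smul, norm_smul, hv, abs_sub_comm]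
  exact (SchwartzMap.compCLMOfAntilipschitz ℝ hg ha f).integrable

/-- For a unit vector, the limit that defines the directional Hilbert transform exists. -/
theorem tendsto_truncated (v : EuclideanSpace ℝ (Fin n)) (hv : ‖v‖ = 1)
    (f : 𝓢(EuclideanSpace ℝ (Fin n), ℂ)) (x : EuclideanSpace ℝ (Fin n)) :
    Tendsto (truncated v f x) (𝓝[>] (0 : ℝ)) (𝓝 ((Real.pi : ℂ) * hilbert v f x)) := by
  set g : ℝ → ℂ := fun t => f (x - t • v) with hg
  have hgi : Integrable g := integrable_line v hv f x
  have hgd : Differentiable ℝ g := f.differentiable.comp (by fun_prop)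
  let k : ℝ → ℂ := (Set.Icc (-1 : ℝ) 1).indicator fun t => g 0 / (t : ℂ)
  let h : ℝ → ℂ := fun t => g t / (t : ℂ) - k t
  have hkodd : ∀ t, k (-t) = -k t := by
    intro t
    by_cases ht : t ∈ Set.Icc (-1 : ℝ) 1
    · have ht' : -t ∈ Set.Icc (-1 : ℝ) 1 := ⟨by linarith [ht.2], by linarith [ht.1]⟩
      simp [k, Set.indicator_of_mem ht, Set.indicator_of_mem ht', div_neg]
    · have ht' : -t ∉ Set.Icc (-1 : ℝ) 1 := fun h' => ht ⟨by linarith [h'.2], by linarith [h'.1]⟩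
      simp [k, Set.indicator_of_notMem ht, Set.indicator_of_notMem ht']
  have hmeas : ∀ ε : ℝ, MeasurableSet {t : ℝ | ε < |t|} := fun ε =>
    measurableSet_lt measurable_const measurable_norm
  have hkm : Measurable k := by
    refine Measurable.indicator ?_ measurableSet_Icc
    exact measurable_const.div Complex.measurable_ofReal
  have hhi : Integrable h := by
    have h1 : IntegrableOn h (Set.Icc (-1 : ℝ) 1) := by
      have hc : IntegrableOn (dslope g 0) (Set.Icc (-1 : ℝ) 1) := by
        refine ContinuousOn.integrableOn_Icc fun t _ => ContinuousAt.continuousWithinAt ?_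
        by_cases ht : t = 0
        · subst ht
          exact continuousAt_dslope_same.2 (hgd 0)
        · exact (continuousAt_dslope_of_ne ht).2 (hgd t).continuousAt
      refine hc.congr ?_
      have h0 : ∀ᵐ t ∂(volume.restrict (Set.Icc (-1 : ℝ) 1)), t ≠ 0 :=
        ae_restrict_of_ae (by simp [ae_iff])
      filter_upwards [h0, ae_restrict_mem measurableSet_Icc] with t ht hmem
      simp only [h, k, Set.indicator_of_mem hmem, dslope_of_ne g ht, slope, vsub_eq_sub, sub_zero,
        Complex.real_smul, Complex.ofReal_inv]
      ring
    have h2 : IntegrableOn h (Set.Icc (-1 : ℝ) 1)ᶜ := by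
      refine Integrable.mono' hgi.norm.integrableOn (AEStronglyMeasurable.restrict ?_) ?_
      · exact ((hgd.continuous.measurable.div Complex.measurable_ofReal).sub
          hkm).aestronglyMeasurable
      · filter_upwards [ae_restrict_mem measurableSet_Icc.compl] with t ht
        have ht1 : 1 ≤ |t| := by
          by_contra hlt
          exact ht (abs_le.1 (not_le.1 hlt).le)
        simp only [h, k, Set.indicator_of_notMem ht, sub_zero, norm_div, Complex.norm_real,
          Real.norm_eq_abs]
        exact div_le_self (norm_nonneg _) ht1
    have := h1.union h2
    rwa [Set.union_compl_self, integrableOn_univ] at this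
  have hkε : ∀ ε : ℝ, 0 < ε → IntegrableOn k {t : ℝ | ε < |t|} := by
    intro ε hε
    have hb : Integrable ((Set.Icc (-1 : ℝ) 1).indicator fun _ => ‖g 0‖ / ε) :=
      (integrable_indicator_iff measurableSet_Icc).2 (by simp)
    refine Integrable.mono' hb.integrableOn hkm.aestronglyMeasurable.restrict ?_
    filter_upwards [ae_restrict_mem (hmeas ε)] with t ht
    have ht' : ε < |t| := ht
    by_cases hmem : t ∈ Set.Icc (-1 : ℝ) 1
    · simp only [k, Set.indicator_of_mem hmem, norm_div, Complex.norm_real, Real.norm_eq_abs]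
      gcongr
    · simp [k, Set.indicator_of_notMem hmem]
  have hk0 : ∀ ε : ℝ, ∫ t in {t : ℝ | ε < |t|}, k t = 0 := by
    intro ε
    rw [← integral_indicator (hmeas ε)]
    set K := {t : ℝ | ε < |t|}.indicator k
    have hK : ∀ t, K (-t) = -K t := by
      intro t
      by_cases ht : ε < |t| <;> simp [K, ht, hkodd]
    have h1 := integral_neg_eq_self K volume
    simp only [hK, integral_neg] at h1
    exact self_eq_neg.1 h1.symm
  have hcover : AECover volume (𝓝[>] (0 : ℝ)) fun ε : ℝ => {t : ℝ | ε < |t|} := by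
    refine ⟨?_, hmeas⟩
    have h0 : ∀ᵐ t : ℝ, t ≠ 0 := by simp [ae_iff]
    filter_upwards [h0] with t ht
    exact nhdsWithin_le_nhds (Iio_mem_nhds (abs_pos.2 ht))
  have hlim : Tendsto (truncated v f x) (𝓝[>] (0 : ℝ)) (𝓝 (∫ t, h t)) := by
    refine (hcover.integral_tendsto_of_countably_generated hhi).congr' ?_
    filter_upwards [self_mem_nhdsWithin] with ε hε
    have hs : ∫ t in {t : ℝ | ε < |t|}, (h t + k t) = ∫ t in {t : ℝ | ε < |t|}, h t := by
      rw [integral_add hhi.integrableOn (hkε ε hε), hk0, add_zero]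
    rw [← hs]
    simp [h, truncated, hg]
  have hpi : (Real.pi : ℂ) ≠ 0 := by exact_mod_cast Real.pi_ne_zero
  have : (Real.pi : ℂ) * hilbert v f x = ∫ t, h t := by
    rw [hilbert, hlim.limUnder_eq, ← mul_assoc, mul_one_div_cancel hpi, one_mul]
  rwa [this]

end DirectionalHilbert

/-!
The argument compares the maximal operators with the partial sums of a lacunary random walk.

*Frequencies.* The multiplier of `T_v` only sees the sign of `ξ⬝v`. In a generic plane at least half
of the vectors of `U` lie in an open half-plane and have distinct slopes. Listing them by slope as
`w 1, …, w M`, one finds frequencies `ξ 1, …, ξ M` with `0 < ξ j⬝w i` if and only if `j ≤ i`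
(`exists_triangular_directions`). If `a` is a fixed Schwartz function and `l` is large, then
`T_{w i}` keeps `e^{2πi l ξ_j⬝x} a(x)` for `j ≤ i` and kills it for `i < j`, up to a uniformly small error
(`halfSpaceMultiplier_modulate`). So on a sum of such terms the operators `T_{w i}` act as the
partial sums in the order of the index `j`. This is the only property of the operators that is
used, see `IsTriangular`.

*The extremal function.* Let `2 ^ k ≤ M + 1`, and arrange the indices `0 < j < 2 ^ k` in a binary
tree by bisection. Over a set `B` of measure one, each point `x` follows a branch of the tree. At a
node `j` it meets the term `g = e^{2πi l ξ_j⬝x}`, and goes to the right, towards larger indices, if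
`0 < Re g`, and to the left otherwise. Let `f` be the sum over the branch of `x` of these `k` terms.
The partial sum up to the leaf of `x` consists of the terms where `x` went to the right, so its
real part is the sum of the positive parts of the real parts, whose mean is of order `k`. If `l`
grows fast enough from one level to the next, then by the Riemann-Lebesgue lemma `f` has the
exponential moments of a random walk with `k` steps, so that its `L^p` norm is of order `√k`. The
tree is built one level at a time (`Stage`, `Stage.succ`), where indicator functions are replaced
by Schwartz functions that are close in `L^p`. The quotient of the two orders is `√k`
(`exists_le_of_isTriangular`), and `k` is comparable to `log_2 #U`.

*The Hilbert transform.* From the Dirichlet integral one has `H_v = -i (2 T_v - 1)` (`hilbert_eq`).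
Hence `2 ‖T_U‖ ≤ 1 + ‖H_U‖`, and `‖H_U‖` is bounded below by a positive constant, because `i H_v`
asymptotically keeps functions of high frequency `l v` (`exists_le_of_norm_hilbert_le`, the case
`k = 1` of the bound for triangular families).
-/

namespace DirectionalHilbert

variable {n : ℕ}

/-! ### Modulated Schwartz functions -/

/-- The Schwartz function `x ↦ e^{2πi η⬝x} a x`. It is defined as the inverse Fourier transform of
the translate of `𝓕 a` by `η`, see `modulate_apply`. -/
noncomputable def modulate (η : EuclideanSpace ℝ (Fin n)) (a : 𝓢(EuclideanSpace ℝ (Fin n), ℂ)) :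
    𝓢(EuclideanSpace ℝ (Fin n), ℂ) :=
  𝓕⁻ ((𝓕 a).compSubConstCLM ℂ η)

theorem fourier_modulate (η : EuclideanSpace ℝ (Fin n)) (a : 𝓢(EuclideanSpace ℝ (Fin n), ℂ))
    (ζ : EuclideanSpace ℝ (Fin n)) : 𝓕 (modulate η a) ζ = 𝓕 a (ζ - η) := by
  simp [modulate]

theorem fourierInv_fourier_apply (a : 𝓢(EuclideanSpace ℝ (Fin n), ℂ))
    (x : EuclideanSpace ℝ (Fin n)) :
    ∫ ζ, Real.fourierChar (inner ℝ ζ x) • 𝓕 a ζ = a x := by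
  rw [← Real.fourierInv_eq, ← SchwartzMap.fourierInv_coe, fourierInv_fourier_eq]

theorem modulate_apply (η : EuclideanSpace ℝ (Fin n)) (a : 𝓢(EuclideanSpace ℝ (Fin n), ℂ))
    (x : EuclideanSpace ℝ (Fin n)) :
    modulate η a x = (Real.fourierChar (inner ℝ η x) : ℂ) * a x := by
  rw [← fourierInv_fourier_apply (modulate η a), ← fourierInv_fourier_apply a,
    ← integral_const_mul, ← integral_add_right_eq_self _ η]
  congr 1 with ζ
  rw [fourier_modulate, add_sub_cancel_right, inner_add_left, AddChar.map_add_eq_mul]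
  simp only [Circle.smul_def, Circle.coe_mul, smul_eq_mul]
  ring

/-! ### The half-space multiplier -/

theorem measurableSet_halfSpace (v : EuclideanSpace ℝ (Fin n)) : MeasurableSet (halfSpace v) :=
  measurableSet_lt measurable_const (by fun_prop)

theorem integrable_indicator_fourier (v : EuclideanSpace ℝ (Fin n))
    (f : 𝓢(EuclideanSpace ℝ (Fin n), ℂ)) :
    Integrable ((halfSpace v).indicator (𝓕 f : 𝓢(EuclideanSpace ℝ (Fin n), ℂ))) :=
  (𝓕 f).integrable.indicator (measurableSet_halfSpace v)

theorem halfSpaceMultiplier_apply (v : EuclideanSpace ℝ (Fin n))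
    (f : 𝓢(EuclideanSpace ℝ (Fin n), ℂ)) (x : EuclideanSpace ℝ (Fin n)) :
    halfSpaceMultiplier v f x = ∫ ζ in halfSpace v, Real.fourierChar (inner ℝ ζ x) • 𝓕 f ζ := by
  rw [halfSpaceMultiplier, Real.fourierInv_eq, ← integral_indicator (measurableSet_halfSpace v)]
  congr 1 with ζ
  by_cases h : ζ ∈ halfSpace v <;> simp [h, SchwartzMap.fourier_coe]

theorem integrable_fourierChar_smul (x : EuclideanSpace ℝ (Fin n))
    (f : 𝓢(EuclideanSpace ℝ (Fin n), ℂ)) :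
    Integrable fun ζ => Real.fourierChar (inner ℝ ζ x) • f ζ := by
  refine f.integrable.mono ?_ (by simp)
  have : Continuous fun ζ : EuclideanSpace ℝ (Fin n) => Real.fourierChar (inner ℝ ζ x) • f ζ :=
    (Real.continuous_fourierChar.comp (by fun_prop)).smul f.continuous
  exact this.aestronglyMeasurable

theorem halfSpaceMultiplier_add (v : EuclideanSpace ℝ (Fin n))
    (f g : 𝓢(EuclideanSpace ℝ (Fin n), ℂ)) :
    halfSpaceMultiplier v (f + g) = halfSpaceMultiplier v f + halfSpaceMultiplier v g := by
  ext x
  simp only [Pi.add_apply, halfSpaceMultiplier_apply]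
  rw [← integral_add (integrable_fourierChar_smul x _).integrableOn
    (integrable_fourierChar_smul x _).integrableOn]
  simp [FourierTransform.fourier_add, smul_add]

theorem continuous_halfSpaceMultiplier (v : EuclideanSpace ℝ (Fin n))
    (f : 𝓢(EuclideanSpace ℝ (Fin n), ℂ)) : Continuous (halfSpaceMultiplier v f) := by
  have h := VectorFourier.fourierIntegral_continuous Real.continuous_fourierChar
    (L := innerₗ (EuclideanSpace ℝ (Fin n))) (by exact continuous_inner)
    (integrable_indicator_fourier v f)
  refine (h.comp continuous_neg).congr fun x => ?_
  exact (Real.fourierInv_eq_fourier_neg _ x).symm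

/-- The mass of an integrable function outside the slab `|ζ⬝v| < r` vanishes as `r → ∞`. -/
theorem tendsto_setIntegral_compl_slab (v : EuclideanSpace ℝ (Fin n))
    {g : EuclideanSpace ℝ (Fin n) → ℝ} (hg : Integrable g) :
    Tendsto (fun r : ℝ => ∫ ζ in {ζ | r ≤ |inner ℝ ζ v|}, g ζ) atTop (𝓝 0) := by
  have hm (r : ℝ) : MeasurableSet {ζ : EuclideanSpace ℝ (Fin n) | r ≤ |inner ℝ ζ v|} :=
    measurableSet_le measurable_const (by fun_prop)
  have h0 : (0 : ℝ) = ∫ _ : EuclideanSpace ℝ (Fin n), (0 : ℝ) := by simp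
  simp_rw [← integral_indicator (hm _)]
  rw [h0]
  refine tendsto_integral_filter_of_dominated_convergence (fun ζ => ‖g ζ‖)
    (Eventually.of_forall fun r => (hg.indicator (hm r)).aestronglyMeasurable)
    (Eventually.of_forall fun r => Eventually.of_forall fun ζ => norm_indicator_le_norm_self _ _)
    hg.norm (Eventually.of_forall fun ζ => ?_)
  refine tendsto_const_nhds.congr' ?_
  filter_upwards [eventually_gt_atTop |inner ℝ ζ v|] with r hr
  simp [hr]

/-- A half-space multiplier keeps a highly modulated function if the frequency points into the
half-space, and kills it if the frequency points away from it, up to an error that is uniform. -/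
theorem halfSpaceMultiplier_modulate (v ξ : EuclideanSpace ℝ (Fin n)) (h : inner ℝ ξ v ≠ 0)
    (a : 𝓢(EuclideanSpace ℝ (Fin n), ℂ)) {δ : ℝ} (hδ : 0 < δ) :
    ∀ᶠ l : ℝ in atTop, ∀ x, ‖halfSpaceMultiplier v (modulate (l • ξ) a) x -
      (if 0 < inner ℝ ξ v then modulate (l • ξ) a x else 0)‖ ≤ δ := by
  have hlim := (tendsto_setIntegral_compl_slab v (𝓕 a).integrable.norm).comp
    (tendsto_id.atTop_mul_const (abs_pos.2 h))
  filter_upwards [hlim.eventually (gt_mem_nhds hδ), eventually_gt_atTop 0] with l hl hl0 x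
  refine le_trans ?_ hl.le
  simp only [Function.comp, id]
  have hsub : ∀ A : Set (EuclideanSpace ℝ (Fin n)), MeasurableSet A →
      (∀ ζ ∈ A, l * |inner ℝ ξ v| ≤ |inner ℝ (ζ - l • ξ) v|) →
      ‖∫ ζ in A, Real.fourierChar (inner ℝ ζ x) • 𝓕 (modulate (l • ξ) a) ζ‖ ≤
        ∫ ζ in {ζ | l * |inner ℝ ξ v| ≤ |inner ℝ ζ v|}, ‖𝓕 a ζ‖ := by
    intro A hA hAs
    have hm : MeasurableSet {ζ : EuclideanSpace ℝ (Fin n) | l * |inner ℝ ξ v| ≤ |inner ℝ ζ v|} :=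
      measurableSet_le measurable_const (by fun_prop)
    refine (norm_integral_le_integral_norm _).trans ?_
    rw [← integral_indicator hA, ← integral_indicator hm,
      ← integral_sub_right_eq_self ({ζ | l * |inner ℝ ξ v| ≤ |inner ℝ ζ v|}.indicator _) (l • ξ)]
    refine integral_mono_of_nonneg (Eventually.of_forall fun ζ => ?_)
      (((𝓕 a).integrable.norm.indicator hm).comp_sub_right (l • ξ))
      (Eventually.of_forall fun ζ => ?_)
    · exact Set.indicator_nonneg (fun _ _ => norm_nonneg _) _
    · simp only [Circle.norm_smul, fourier_modulate]
      by_cases hζ : ζ ∈ A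
      · have hmem : ζ - l • ξ ∈ {ζ | l * |inner ℝ ξ v| ≤ |inner ℝ ζ v|} := hAs ζ hζ
        rw [Set.indicator_of_mem hζ, Set.indicator_of_mem hmem]
      · rw [Set.indicator_of_notMem hζ]
        exact Set.indicator_nonneg (fun _ _ => norm_nonneg _) _
  have hi := integrable_fourierChar_smul x (𝓕 (modulate (l • ξ) a))
  rcases lt_or_gt_of_ne h with hneg | hpos
  · rw [if_neg hneg.le.not_gt, sub_zero, halfSpaceMultiplier_apply]
    refine hsub _ (measurableSet_halfSpace v) fun ζ (hζ : 0 < inner ℝ ζ v) => ?_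
    rw [inner_sub_left, real_inner_smul_left, abs_of_neg hneg, abs_of_nonneg] <;>
      nlinarith [mul_pos hl0 (neg_pos.2 hneg)]
  · rw [if_pos hpos, halfSpaceMultiplier_apply, ← fourierInv_fourier_apply (modulate (l • ξ) a),
      ← integral_add_compl (measurableSet_halfSpace v) hi, sub_add_cancel_left, norm_neg]
    refine hsub _ (measurableSet_halfSpace v).compl fun ζ hζ => ?_
    have hζ : inner ℝ ζ v ≤ 0 := not_lt.1 hζ
    rw [inner_sub_left, real_inner_smul_left, abs_of_pos hpos, abs_of_nonpos] <;>
      nlinarith [mul_pos hl0 hpos]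

/-! ### The Dirichlet integral -/

theorem integral_sin_mul_exp_neg (s R : ℝ) :
    ∫ t in (0 : ℝ)..R, Real.sin t * Real.exp (-(s * t)) =
      (1 - Real.exp (-(s * R)) * (Real.cos R + s * Real.sin R)) / (1 + s ^ 2) := by
  have hs : 1 + s ^ 2 ≠ 0 := by positivity
  have hd : ∀ t : ℝ, HasDerivAt
      (fun t => -(Real.exp (-(s * t)) * (Real.cos t + s * Real.sin t)) / (1 + s ^ 2))
      (Real.sin t * Real.exp (-(s * t))) t := by
    intro t
    have h1 : HasDerivAt (fun t : ℝ => Real.exp (-(s * t))) (Real.exp (-(s * t)) * (-(s * 1))) t :=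
      (((hasDerivAt_id t).const_mul s).neg).exp
    have h2 := (Real.hasDerivAt_cos t).add ((Real.hasDerivAt_sin t).const_mul s)
    convert! ((h1.mul h2).neg).div_const (1 + s ^ 2) using 1
    simp only [Pi.add_apply]
    field_simp
    ring
  rw [intervalIntegral.integral_eq_sub_of_hasDerivAt (fun t _ => hd t)
    (Continuous.intervalIntegrable (by fun_prop) _ _)]
  field_simp
  simp
  ring

/-- The integral of `sinc` as an integral of a rational function with an exponentially small
perturbation, from `1 / t = ∫ e^{-st} ds`. -/
theorem integral_sinc_eq {R : ℝ} (hR : 0 ≤ R) :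
    ∫ t in (0 : ℝ)..R, Real.sinc t = ∫ s in Set.Ioi (0 : ℝ),
      (1 - Real.exp (-(s * R)) * (Real.cos R + s * Real.sin R)) / (1 + s ^ 2) := by
  have hexp : ∀ t : ℝ, 0 < t → IntegrableOn (fun s => Real.exp (-(s * t))) (Set.Ioi 0) ∧
      ∫ s in Set.Ioi (0 : ℝ), Real.exp (-(s * t)) = 1 / t := by
    intro t ht
    have h1 := integrableOn_exp_mul_Ioi (neg_lt_zero.2 ht) 0
    have h2 := integral_exp_mul_Ioi (neg_lt_zero.2 ht) 0
    simp only [neg_mul, mul_comm t, mul_zero, Real.exp_zero, neg_div_neg_eq] at h1 h2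
    exact ⟨h1, by simpa using h2⟩
  have hint : Integrable (Function.uncurry fun t s : ℝ => Real.sin t * Real.exp (-(s * t)))
      ((volume.restrict (Set.Ioc 0 R)).prod (volume.restrict (Set.Ioi 0))) := by
    rw [integrable_prod_iff (by
      refine Continuous.aestronglyMeasurable ?_
      simp only [Function.uncurry_def]
      fun_prop)]
    constructor
    · filter_upwards [ae_restrict_mem measurableSet_Ioc] with t ht
      exact (hexp t ht.1).1.const_mul (Real.sin t)
    · refine Integrable.congr (f := fun t => |Real.sinc t|) ?_ ?_
      · exact (Real.continuous_sinc.abs.integrableOn_Icc).mono_set Set.Ioc_subset_Icc_self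
      · filter_upwards [ae_restrict_mem measurableSet_Ioc] with t ht
        simp only [Function.uncurry_apply_pair, norm_mul, Real.norm_eq_abs, Real.abs_exp]
        rw [integral_const_mul, (hexp t ht.1).2, Real.sinc_of_ne_zero ht.1.ne', abs_div,
          abs_of_pos ht.1, mul_one_div]
  calc ∫ t in (0 : ℝ)..R, Real.sinc t
      = ∫ t in Set.Ioc 0 R, ∫ s in Set.Ioi (0 : ℝ), Real.sin t * Real.exp (-(s * t)) := by
        rw [intervalIntegral.integral_of_le hR]
        refine setIntegral_congr_fun measurableSet_Ioc fun t ht => ?_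
        rw [integral_const_mul, (hexp t ht.1).2, Real.sinc_of_ne_zero ht.1.ne', mul_one_div]
    _ = ∫ s in Set.Ioi (0 : ℝ), ∫ t in Set.Ioc 0 R, Real.sin t * Real.exp (-(s * t)) :=
        integral_integral_swap hint
    _ = _ := by
        refine setIntegral_congr_fun measurableSet_Ioi fun s _ => ?_
        rw [← intervalIntegral.integral_of_le hR, integral_sin_mul_exp_neg]

theorem tendsto_integral_sinc_atTop :
    Tendsto (fun R : ℝ => ∫ t in (0 : ℝ)..R, Real.sinc t) atTop (𝓝 (Real.pi / 2)) := by
  have hlim : Tendsto (fun R : ℝ => ∫ s in Set.Ioi (0 : ℝ),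
      (1 - Real.exp (-(s * R)) * (Real.cos R + s * Real.sin R)) / (1 + s ^ 2)) atTop
      (𝓝 (∫ s in Set.Ioi (0 : ℝ), (1 + s ^ 2)⁻¹)) := by
    refine tendsto_integral_filter_of_dominated_convergence (fun s => 2 * (1 + s ^ 2)⁻¹) ?_ ?_
      (integrable_inv_one_add_sq.const_mul 2).integrableOn ?_
    · refine Eventually.of_forall fun R => Measurable.aestronglyMeasurable ?_
      fun_prop
    · filter_upwards [eventually_ge_atTop 1] with R hR
      filter_upwards [ae_restrict_mem measurableSet_Ioi] with s hs
      have hs : 0 < s := hs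
      rw [div_eq_mul_inv, norm_mul, Real.norm_eq_abs, Real.norm_of_nonneg (by positivity)]
      gcongr
      have h1 : Real.exp (-(s * R)) * (1 + s) ≤ 1 := by
        rw [Real.exp_neg, inv_mul_le_iff₀ (Real.exp_pos _), mul_one]
        nlinarith [Real.add_one_le_exp (s * R)]
      have h2 : |Real.cos R + s * Real.sin R| ≤ 1 + s := by
        refine (abs_add_le _ _).trans (add_le_add (Real.abs_cos_le_one R) ?_)
        rw [abs_mul, abs_of_pos hs]
        nlinarith [Real.abs_sin_le_one R]
      have h3 : |Real.exp (-(s * R)) * (Real.cos R + s * Real.sin R)| ≤ 1 := by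
        rw [abs_mul, Real.abs_exp]
        exact (mul_le_mul_of_nonneg_left h2 (Real.exp_pos _).le).trans h1
      rw [abs_le] at h3 ⊢
      constructor <;> linarith
    · filter_upwards [ae_restrict_mem measurableSet_Ioi] with s hs
      have hs : 0 < s := hs
      have h0 : Tendsto (fun R : ℝ => Real.exp (-(s * R)) * (Real.cos R + s * Real.sin R)) atTop
          (𝓝 0) := by
        refine squeeze_zero_norm (a := fun R => Real.exp (-(s * R)) * (1 + s)) (fun R => ?_) ?_
        · rw [norm_mul, Real.norm_eq_abs, Real.abs_exp]
          gcongr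
          refine (abs_add_le _ _).trans (add_le_add (Real.abs_cos_le_one R) ?_)
          rw [abs_mul, abs_of_pos hs]
          nlinarith [Real.abs_sin_le_one R]
        · simpa using ((Real.tendsto_exp_neg_atTop_nhds_zero.comp
            (tendsto_id.const_mul_atTop hs))).mul_const (1 + s)
      simpa using (h0.const_sub 1).div_const (1 + s ^ 2)
  rw [integral_Ioi_inv_one_add_sq, Real.arctan_zero, sub_zero] at hlim
  refine hlim.congr' ?_
  filter_upwards [eventually_ge_atTop 0] with R hR
  rw [integral_sinc_eq hR]

theorem integral_sinc_neg (R : ℝ) :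
    ∫ t in (0 : ℝ)..-R, Real.sinc t = -∫ t in (0 : ℝ)..R, Real.sinc t := by
  have h := intervalIntegral.integral_comp_neg (a := 0) (b := R) Real.sinc
  simp only [Real.sinc_neg, neg_zero] at h
  rw [h, intervalIntegral.integral_symm]

theorem continuous_integral_sinc : Continuous fun R : ℝ => ∫ t in (0 : ℝ)..R, Real.sinc t :=
  intervalIntegral.continuous_primitive
    (fun _ _ => Real.continuous_sinc.intervalIntegrable _ _) 0

theorem exists_integral_sinc_le : ∃ M : ℝ, ∀ R : ℝ, |∫ t in (0 : ℝ)..R, Real.sinc t| ≤ M := by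
  obtain ⟨R₀, h⟩ := eventually_atTop.1
    ((tendsto_integral_sinc_atTop.abs).eventually (Iic_mem_nhds (lt_add_one _)))
  obtain ⟨M, hM⟩ := isCompact_Icc.exists_bound_of_continuousOn (s := Set.Icc 0 R₀)
    continuous_integral_sinc.continuousOn
  have hpos : ∀ R : ℝ, 0 ≤ R →
      |∫ t in (0 : ℝ)..R, Real.sinc t| ≤ max M (|Real.pi / 2| + 1) := by
    intro R hR
    rcases le_total R R₀ with h1 | h1
    · exact le_max_of_le_left (hM R ⟨hR, h1⟩)
    · exact le_max_of_le_right (h R h1)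
  refine ⟨max M (|Real.pi / 2| + 1), fun R => ?_⟩
  rcases le_total 0 R with h1 | h1
  · exact hpos R h1
  · rw [← neg_neg R, integral_sinc_neg, abs_neg]
    exact hpos _ (neg_nonneg.2 h1)

/-! ### The Hilbert transform as a multiplier -/

theorem setIntegral_sin_div (c : ℝ) {ε R : ℝ} (hε : 0 < ε) (hR : ε ≤ R) :
    ∫ t in Set.Ioc ε R, Real.sin (2 * Real.pi * c * t) / t =
      (∫ t in (0 : ℝ)..2 * Real.pi * c * R, Real.sinc t) -
        ∫ t in (0 : ℝ)..2 * Real.pi * c * ε, Real.sinc t := by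
  rw [intervalIntegral.integral_interval_sub_left
      (Real.continuous_sinc.intervalIntegrable _ _) (Real.continuous_sinc.intervalIntegrable _ _),
    ← intervalIntegral.mul_integral_comp_mul_left, intervalIntegral.integral_of_le hR,
    ← integral_const_mul]
  refine setIntegral_congr_fun measurableSet_Ioc fun t ht => ?_
  have ht0 : t ≠ 0 := (hε.trans ht.1).ne'
  by_cases hc : c = 0
  · simp [hc]
  · have h0 : 2 * Real.pi * c * t ≠ 0 := by
      have := Real.pi_ne_zero
      positivity
    rw [Real.sinc_of_ne_zero h0]
    field_simp

theorem fourierChar_neg_sub (y : ℝ) :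
    (Real.fourierChar (-y) : ℂ) - Real.fourierChar y =
      -2 * Complex.I * (Real.sin (2 * Real.pi * y) : ℝ) := by
  rw [Real.fourierChar_apply, Real.fourierChar_apply, Complex.exp_mul_I, Complex.exp_mul_I]
  push_cast
  rw [mul_neg, Complex.cos_neg, Complex.sin_neg]
  ring

theorem truncated_eq (v : EuclideanSpace ℝ (Fin n)) (hv : ‖v‖ = 1)
    (f : 𝓢(EuclideanSpace ℝ (Fin n), ℂ)) (x : EuclideanSpace ℝ (Fin n)) {ε : ℝ} (hε : 0 < ε) :
    IntegrableOn (fun t : ℝ => (f (x - t • v) - f (x + t • v)) / (t : ℂ)) (Set.Ioi ε) ∧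
    truncated v f x ε = ∫ t in Set.Ioi ε, (f (x - t • v) - f (x + t • v)) / (t : ℂ) := by
  have hset : {t : ℝ | ε < |t|} = Set.Iio (-ε) ∪ Set.Ioi ε := by
    ext t
    simp only [Set.mem_ofPred_eq, lt_abs, Set.mem_union, Set.mem_Iio, Set.mem_Ioi]
    constructor <;> rintro (h | h) <;> [right; left; right; left] <;> linarith
  have hi : IntegrableOn (fun t : ℝ => f (x - t • v) / (t : ℂ)) {t : ℝ | ε < |t|} := by
    have hg := integrable_line v hv f x
    refine Integrable.mono' (hg.norm.const_mul ε⁻¹).integrableOn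
      ((hg.aestronglyMeasurable.restrict.aemeasurable.div
        Complex.measurable_ofReal.aemeasurable).aestronglyMeasurable) ?_
    filter_upwards [ae_restrict_mem (measurableSet_lt measurable_const measurable_norm)] with t ht
    have ht : ε < |t| := ht
    rw [norm_div, Complex.norm_real, Real.norm_eq_abs, div_eq_inv_mul]
    gcongr
  rw [hset] at hi
  have h1 := hi.mono_set Set.subset_union_left
  have h2 := hi.mono_set Set.subset_union_right
  have h3 : IntegrableOn (fun t : ℝ => f (x - (-t) • v) / ((-t : ℝ) : ℂ)) (Set.Ioi ε) := by
    have h := (integrableOn_Iic_iff_integrableOn_Iio (μ := volume)).2 h1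
    rw [← integrableOn_Ici_iff_integrableOn_Ioi]
    simpa using h.comp_neg
  have heq : ∀ t : ℝ, (f (x - t • v) - f (x + t • v)) / (t : ℂ) =
      f (x - (-t) • v) / ((-t : ℝ) : ℂ) + f (x - t • v) / (t : ℂ) := by
    intro t
    rw [neg_smul, sub_neg_eq_add]
    push_cast
    ring
  simp_rw [heq]
  refine ⟨h3.add h2, ?_⟩
  rw [integral_add h3 h2, truncated, hset, setIntegral_union ?_ measurableSet_Ioi h1 h2]
  · rw [integral_comp_neg_Ioi ε fun t : ℝ => f (x - t • v) / (t : ℂ),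
      integral_Iic_eq_integral_Iio]
  · exact Set.Iio_disjoint_Ioi_of_le (by linarith)

/-- The truncated integral over `ε < |t| ≤ R` on the Fourier side. -/
theorem setIntegral_truncated_eq (v : EuclideanSpace ℝ (Fin n))
    (f : 𝓢(EuclideanSpace ℝ (Fin n), ℂ)) (x : EuclideanSpace ℝ (Fin n)) {ε R : ℝ} (hε : 0 < ε)
    (hR : ε ≤ R) :
    ∫ t in Set.Ioc ε R, (f (x - t • v) - f (x + t • v)) / (t : ℂ) =
      ∫ ζ, (Real.fourierChar (inner ℝ ζ x) • 𝓕 f ζ) * (-2 * Complex.I *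
        (((∫ t in (0 : ℝ)..2 * Real.pi * inner ℝ ζ v * R, Real.sinc t) -
          ∫ t in (0 : ℝ)..2 * Real.pi * inner ℝ ζ v * ε, Real.sinc t : ℝ) : ℂ)) := by
  set K : ℝ → EuclideanSpace ℝ (Fin n) → ℂ := fun t ζ =>
    (Real.fourierChar (inner ℝ ζ x) • 𝓕 f ζ) *
      (-2 * Complex.I * ((Real.sin (2 * Real.pi * inner ℝ ζ v * t) / t : ℝ) : ℂ)) with hK
  have hcont : Continuous fun ζ : EuclideanSpace ℝ (Fin n) =>
      Real.fourierChar (inner ℝ ζ x) • 𝓕 f ζ :=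
    (Real.continuous_fourierChar.comp (by fun_prop)).smul (𝓕 f).continuous
  have hint : Integrable (Function.uncurry K)
      ((volume.restrict (Set.Ioc ε R)).prod volume) := by
    have hb := Integrable.mul_prod (μ := volume.restrict (Set.Ioc ε R))
      (integrable_const (2 * ε⁻¹)) ((𝓕 f).integrable (μ := volume)).norm
    refine hb.mono' ?_ ?_
    · refine Measurable.aestronglyMeasurable ?_
      refine (hcont.measurable.comp measurable_snd).mul (measurable_const.mul
        (Complex.measurable_ofReal.comp ?_))
      exact Measurable.div (Continuous.measurable (by fun_prop)) measurable_fst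
    · have hmem : ∀ᵐ z ∂((volume.restrict (Set.Ioc ε R)).prod
          (volume : Measure (EuclideanSpace ℝ (Fin n)))), z.1 ∈ Set.Ioc ε R :=
        Measure.quasiMeasurePreserving_fst.ae (ae_restrict_mem measurableSet_Ioc)
      filter_upwards [hmem] with z hz
      have hz0 : 0 < z.1 := hε.trans hz.1
      simp only [Function.uncurry_def, hK, norm_mul, Circle.norm_smul, Complex.norm_real, norm_div,
        Real.norm_eq_abs, norm_neg, Complex.norm_ofNat, Complex.norm_I, mul_one]
      rw [mul_comm, abs_of_pos hz0, div_eq_mul_inv]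
      have h1 : |Real.sin (2 * Real.pi * inner ℝ z.2 v * z.1)| * z.1⁻¹ ≤ 1 * ε⁻¹ :=
        mul_le_mul (Real.abs_sin_le_one _) (inv_anti₀ hε hz.1.le) (by positivity) zero_le_one
      rw [one_mul] at h1
      gcongr
  calc ∫ t in Set.Ioc ε R, (f (x - t • v) - f (x + t • v)) / (t : ℂ)
      = ∫ t in Set.Ioc ε R, ∫ ζ, K t ζ := by
        refine setIntegral_congr_fun measurableSet_Ioc fun t ht => ?_
        rw [← fourierInv_fourier_apply f (x - t • v), ← fourierInv_fourier_apply f (x + t • v),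
          ← integral_sub (integrable_fourierChar_smul _ _) (integrable_fourierChar_smul _ _),
          ← integral_div]
        congr 1 with ζ
        simp only [hK, sub_eq_add_neg x, inner_add_right, inner_neg_right, real_inner_smul_right,
          AddChar.map_add_eq_mul, Circle.smul_def, Circle.coe_mul, smul_eq_mul]
        have := fourierChar_neg_sub (t * inner ℝ ζ v)
        rw [show 2 * Real.pi * (t * inner ℝ ζ v) = 2 * Real.pi * inner ℝ ζ v * t by ring] at this
        push_cast at this ⊢
        linear_combination (Real.fourierChar (inner ℝ ζ x) * 𝓕 f ζ / t : ℂ) * this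
    _ = ∫ ζ, ∫ t in Set.Ioc ε R, K t ζ := integral_integral_swap hint
    _ = _ := by
        congr 1 with ζ
        simp only [hK]
        rw [integral_const_mul, integral_const_mul, integral_complex_ofReal, setIntegral_sin_div _ hε hR]

/-- The set of frequencies orthogonal to a nonzero vector is negligible. -/
theorem ae_inner_ne_zero (v : EuclideanSpace ℝ (Fin n)) (hv : v ≠ 0) :
    ∀ᵐ ζ : EuclideanSpace ℝ (Fin n), inner ℝ ζ v ≠ 0 := by
  have h := Measure.addHaar_submodule (volume : Measure (EuclideanSpace ℝ (Fin n))) (ℝ ∙ v)ᗮ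
    (fun h => hv (by simpa using h))
  rw [ae_iff]
  convert h using 2
  ext ζ
  simp [Submodule.mem_orthogonal_singleton_iff_inner_left]

/-- The directional Hilbert transform has the multiplier `-i sgn (ξ⬝v)`, that is
`H_v = -i (2 T_v - 1)`. -/
theorem hilbert_eq (v : EuclideanSpace ℝ (Fin n)) (hv : ‖v‖ = 1)
    (f : 𝓢(EuclideanSpace ℝ (Fin n), ℂ)) (x : EuclideanSpace ℝ (Fin n)) :
    hilbert v f x = -Complex.I * (2 * halfSpaceMultiplier v f x - f x) := by
  have hv0 : v ≠ 0 := by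
    rintro rfl
    simp at hv
  obtain ⟨M, hM⟩ := exists_integral_sinc_le
  have hi := integrable_fourierChar_smul x (𝓕 f)
  have hpi := Real.pi_pos
  -- The truncation `R⁻¹ < |t| ≤ R` is used, so that both ends are governed by one parameter.
  have hmain : Tendsto (fun R : ℝ =>
      ∫ t in Set.Ioc R⁻¹ R, (f (x - t • v) - f (x + t • v)) / (t : ℂ)) atTop
      (𝓝 (∫ ζ, (Real.fourierChar (inner ℝ ζ x) • 𝓕 f ζ) *
        (-Complex.I * Real.pi * (if 0 < inner ℝ ζ v then 1 else -1)))) := by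
    have hl : Tendsto (fun R : ℝ => ∫ ζ, (Real.fourierChar (inner ℝ ζ x) • 𝓕 f ζ) *
        (-2 * Complex.I *
        (((∫ t in (0 : ℝ)..2 * Real.pi * inner ℝ ζ v * R, Real.sinc t) -
          ∫ t in (0 : ℝ)..2 * Real.pi * inner ℝ ζ v * R⁻¹, Real.sinc t : ℝ) : ℂ))) atTop
        (𝓝 (∫ ζ, (Real.fourierChar (inner ℝ ζ x) • 𝓕 f ζ) *
        (-Complex.I * Real.pi * (if 0 < inner ℝ ζ v then 1 else -1)))) := by
      refine tendsto_integral_filter_of_dominated_convergence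
        (fun ζ => ‖𝓕 f ζ‖ * (2 * (M + M))) (Eventually.of_forall fun R => ?_)
        (Eventually.of_forall fun R => Eventually.of_forall fun ζ => ?_)
        ((𝓕 f).integrable.norm.mul_const _) ?_
      · refine hi.aestronglyMeasurable.mul (Continuous.aestronglyMeasurable ?_)
        refine continuous_const.mul (Complex.continuous_ofReal.comp
          ((continuous_integral_sinc.comp ?_).sub (continuous_integral_sinc.comp ?_))) <;> fun_prop
      · rw [norm_mul, Circle.norm_smul]
        refine mul_le_mul_of_nonneg_left ?_ (norm_nonneg _)
        rw [norm_mul, Complex.norm_real]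
        have : ‖-2 * Complex.I‖ = 2 := by simp
        rw [this]
        refine mul_le_mul_of_nonneg_left ?_ zero_le_two
        exact (norm_sub_le _ _).trans (add_le_add (hM _) (hM _))
      · filter_upwards [ae_inner_ne_zero v hv0] with ζ hζ
        refine Tendsto.const_mul _ ?_
        have h2 : Tendsto (fun R : ℝ =>
            ∫ t in (0 : ℝ)..2 * Real.pi * inner ℝ ζ v * R⁻¹, Real.sinc t) atTop (𝓝 0) := by
          have := (continuous_integral_sinc.tendsto 0).comp
            (by simpa using tendsto_inv_atTop_zero.const_mul (2 * Real.pi * inner ℝ ζ v) :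
              Tendsto (fun R : ℝ => 2 * Real.pi * inner ℝ ζ v * R⁻¹) atTop (𝓝 0))
          simpa [Function.comp_def] using this
        have h3 : ∀ {L : ℝ}, Tendsto (fun R : ℝ =>
            ∫ t in (0 : ℝ)..2 * Real.pi * inner ℝ ζ v * R, Real.sinc t) atTop (𝓝 L) →
            Tendsto (fun R : ℝ => -2 * Complex.I *
              (((∫ t in (0 : ℝ)..2 * Real.pi * inner ℝ ζ v * R, Real.sinc t) -
                ∫ t in (0 : ℝ)..2 * Real.pi * inner ℝ ζ v * R⁻¹, Real.sinc t : ℝ) : ℂ)) atTop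
              (𝓝 (-2 * Complex.I * (L : ℂ))) := by
          intro L hL
          have := ((Complex.continuous_ofReal.tendsto _).comp (hL.sub h2)).const_mul
            (-2 * Complex.I)
          rwa [sub_zero] at this
        rcases lt_or_gt_of_ne hζ with h | h
        · have h1 : Tendsto (fun R : ℝ =>
              ∫ t in (0 : ℝ)..2 * Real.pi * inner ℝ ζ v * R, Real.sinc t) atTop
              (𝓝 (-(Real.pi / 2))) := by
            have hc : 0 < -(2 * Real.pi * inner ℝ ζ v) := by nlinarith
            refine (tendsto_integral_sinc_atTop.comp (tendsto_id.const_mul_atTop hc)).neg.congr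
              fun R => ?_
            rw [Function.comp, ← integral_sinc_neg]
            simp
          rw [if_neg h.le.not_gt]
          convert h3 h1 using 2
          push_cast
          ring
        · have h1 : Tendsto (fun R : ℝ =>
              ∫ t in (0 : ℝ)..2 * Real.pi * inner ℝ ζ v * R, Real.sinc t) atTop
              (𝓝 (Real.pi / 2)) := by
            have hc : 0 < 2 * Real.pi * inner ℝ ζ v := by positivity
            exact tendsto_integral_sinc_atTop.comp (tendsto_id.const_mul_atTop hc)
          rw [if_pos h]
          convert h3 h1 using 2
          push_cast
          ring
    refine hl.congr' ?_
    filter_upwards [eventually_ge_atTop 1] with R hR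
    have hR0 : 0 < R := zero_lt_one.trans_le hR
    exact (setIntegral_truncated_eq v f x (inv_pos.2 hR0)
      ((inv_le_one_of_one_le₀ hR).trans hR)).symm
  have htail : Tendsto (fun R : ℝ =>
      ∫ t in Set.Ioi R, (f (x - t • v) - f (x + t • v)) / (t : ℂ)) atTop (𝓝 0) := by
    have h := (truncated_eq v hv f x zero_lt_one).1
    have := tendsto_setIntegral_of_antitone (μ := volume) (fun R : ℝ => measurableSet_Ioi (a := R))
      (fun _ _ h => Set.Ioi_subset_Ioi h) ⟨1, h⟩
    have he : (⋂ R : ℝ, Set.Ioi R) = ∅ := by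
      ext t
      simpa using ⟨t, le_rfl⟩
    simpa [he] using this
  have hlim : Tendsto (fun R : ℝ => truncated v f x R⁻¹) atTop
      (𝓝 (∫ ζ, (Real.fourierChar (inner ℝ ζ x) • 𝓕 f ζ) *
        (-Complex.I * Real.pi * (if 0 < inner ℝ ζ v then 1 else -1)))) := by
    have h := hmain.add htail
    rw [add_zero] at h
    refine h.congr' ?_
    filter_upwards [eventually_ge_atTop 1] with R hR
    have hR0 : 0 < R := zero_lt_one.trans_le hR
    have hle : R⁻¹ ≤ R := (inv_le_one_of_one_le₀ hR).trans hR
    obtain ⟨h1, h2⟩ := truncated_eq v hv f x (inv_pos.2 hR0)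
    rw [h2, ← Set.Ioc_union_Ioi_eq_Ioi hle,
      setIntegral_union (Set.Ioc_disjoint_Ioi le_rfl) measurableSet_Ioi
        (h1.mono_set Set.Ioc_subset_Ioi_self) (h1.mono_set (Set.Ioi_subset_Ioi hle))]
  have huniq := tendsto_nhds_unique ((tendsto_truncated v hv f x).comp
    tendsto_inv_atTop_nhdsGT_zero) hlim
  have hind : ∀ ζ, (Real.fourierChar (inner ℝ ζ x) • 𝓕 f ζ) *
      (-Complex.I * Real.pi * (if 0 < inner ℝ ζ v then 1 else -1)) =
      (-Complex.I * Real.pi) * (2 * (halfSpace v).indicator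
        (fun ζ => Real.fourierChar (inner ℝ ζ x) • 𝓕 f ζ) ζ -
          Real.fourierChar (inner ℝ ζ x) • 𝓕 f ζ) := by
    intro ζ
    by_cases h : 0 < inner ℝ ζ v
    · rw [if_pos h, Set.indicator_of_mem (show ζ ∈ halfSpace v from h)]
      ring
    · rw [if_neg h, Set.indicator_of_notMem (show ζ ∉ halfSpace v from h)]
      ring
  simp_rw [hind] at huniq
  rw [integral_const_mul, integral_sub ((hi.indicator (measurableSet_halfSpace v)).const_mul 2) hi,
    integral_const_mul, integral_indicator (measurableSet_halfSpace v),
    ← halfSpaceMultiplier_apply, fourierInv_fourier_apply] at huniq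
  have hpi' : (Real.pi : ℂ) ≠ 0 := by exact_mod_cast hpi.ne'
  apply mul_left_cancel₀ hpi'
  rw [huniq]
  ring

/-! ### Choice of directions -/

/-- A finite set of nonzero vectors is missed by some hyperplane. -/
theorem exists_forall_inner_ne_zero (F : Finset (EuclideanSpace ℝ (Fin n)))
    (hF : ∀ u ∈ F, u ≠ 0) : ∃ e : EuclideanSpace ℝ (Fin n), ∀ u ∈ F, inner ℝ e u ≠ 0 := by
  classical
  have h := Subspace.biUnion_ne_univ_of_top_notMem (s := F.image fun u => (ℝ ∙ u)ᗮ) (by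
    simp only [Finset.mem_image, not_exists, not_and]
    intro u hu h
    exact hF u hu (by simpa using h))
  rw [Set.ne_univ_iff_exists_notMem] at h
  obtain ⟨e, he⟩ := h
  refine ⟨e, fun u hu h0 => he ?_⟩
  simp only [Finset.mem_image, Set.iUnion_exists, Set.biUnion_and', Set.iUnion_iUnion_eq_right,
    Set.mem_iUnion]
  exact ⟨u, hu, Submodule.mem_orthogonal_singleton_iff_inner_left.2 h0⟩

/-- At least half of a finite set `U` of unit vectors can be listed as `w 1, …, w M` such that some
frequencies `ξ 1, …, ξ M` are separated by the half-spaces in a triangular pattern: `ξ j` lies in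
the half-space of `w i` if `j ≤ i`, and in the opposite one if `i < j`.

In the coordinates `(e⬝v, e'⬝v)` of a generic plane the vectors `v` with `e⬝v > 0` have distinct
slopes. They are listed by slope, and `ξ j` is orthogonal to a slope just below that of `w j`. -/
theorem exists_triangular_directions (U : Finset (EuclideanSpace ℝ (Fin n)))
    (hU : ∀ v ∈ U, ‖v‖ = 1) :
    ∃ (M : ℕ) (w ξ : ℕ → EuclideanSpace ℝ (Fin n)), U.card ≤ 2 * M ∧
      ∀ i, 0 < i → i ≤ M → w i ∈ U ∧ ∀ j, 0 < j → j ≤ M →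
        inner ℝ (ξ j) (w i) ≠ 0 ∧ (0 < inner ℝ (ξ j) (w i) ↔ j ≤ i) := by
  classical
  obtain ⟨e₀, he₀⟩ := exists_forall_inner_ne_zero U fun v hv h => by
    simpa [h] using hU v hv
  obtain ⟨e, he⟩ : ∃ e : EuclideanSpace ℝ (Fin n),
      U.card ≤ 2 * (U.filter fun v => 0 < inner ℝ e v).card := by
    have hsum := Finset.card_filter_add_card_filter_not (s := U) (fun v => 0 < inner ℝ e₀ v)
    have hcongr : (U.filter fun v => ¬ 0 < inner ℝ e₀ v) =
        U.filter fun v => 0 < inner ℝ (-e₀) v := by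
      refine Finset.filter_congr fun v hv => ?_
      rw [inner_neg_left, neg_pos, not_lt]
      exact ⟨fun h => lt_of_le_of_ne h (he₀ v hv), le_of_lt⟩
    rw [hcongr] at hsum
    by_cases h : U.card ≤ 2 * (U.filter fun v => 0 < inner ℝ e₀ v).card
    · exact ⟨e₀, h⟩
    · exact ⟨-e₀, by omega⟩
  set V := U.filter fun v => 0 < inner ℝ e v with hV
  have hVpos : ∀ v ∈ V, 0 < inner ℝ e v := fun v hv => (Finset.mem_filter.1 hv).2
  have hVU : ∀ v ∈ V, v ∈ U := fun v hv => (Finset.mem_filter.1 hv).1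
  obtain ⟨e', he'⟩ := exists_forall_inner_ne_zero
    (((V ×ˢ V).filter fun q => q.1 ≠ q.2).image
      fun q => inner ℝ e q.2 • q.1 - inner ℝ e q.1 • q.2) (by
    simp only [Finset.mem_image, Finset.mem_filter, Finset.mem_product]
    rintro _ ⟨⟨v, w⟩, ⟨⟨hv, hw⟩, hne⟩, rfl⟩ h
    refine hne ?_
    simp only at hv hw h ⊢
    -- Two unit vectors that are positive multiples of each other agree.
    have h1 : inner ℝ e w • v = inner ℝ e v • w := sub_eq_zero.1 h
    have h2 := congrArg norm h1
    rw [norm_smul, norm_smul, hU v (hVU v hv), hU w (hVU w hw), Real.norm_of_nonneg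
      (hVpos w hw).le, Real.norm_of_nonneg (hVpos v hv).le, mul_one, mul_one] at h2
    rw [h2] at h1
    exact smul_right_injective _ (hVpos v hv).ne' h1)
  set s : EuclideanSpace ℝ (Fin n) → ℝ := fun v => inner ℝ e' v / inner ℝ e v with hs
  have hinj : Set.InjOn s V := by
    intro v hv w hw h
    by_contra hne
    refine he' _ (Finset.mem_image.2 ⟨(v, w), Finset.mem_filter.2
      ⟨Finset.mem_product.2 ⟨hv, hw⟩, hne⟩, rfl⟩) ?_
    have h3 := (hVpos v hv).ne'
    have h4 := (hVpos w hw).ne'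
    simp only [hs] at h
    rw [div_eq_div_iff h3 h4] at h
    simp only [inner_sub_right, real_inner_smul_right]
    linarith
  have hcard : (V.image s).card = V.card := Finset.card_image_of_injOn hinj
  set σ := (V.image s).orderEmbOfFin hcard with hσ
  have hσm : ∀ i, ∃ v ∈ V, s v = σ i := fun i =>
    Finset.mem_image.1 ((V.image s).orderEmbOfFin_mem hcard i)
  choose w hwV hws using hσm
  have hτ : ∀ j, ∃ τ, τ < σ j ∧ ∀ i, i < j → σ i < τ := by
    intro j
    have h1 : ∀ᶠ τ in 𝓝[<] σ j, ∀ i, i < j → σ i < τ := by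
      refine eventually_all.2 fun i => ?_
      by_cases hij : i < j
      · filter_upwards [nhdsWithin_le_nhds (lt_mem_nhds (σ.strictMono hij))] with τ h _ using h
      · exact Eventually.of_forall fun τ h => absurd h hij
    obtain ⟨τ, h⟩ := (h1.and self_mem_nhdsWithin).exists
    exact ⟨τ, h.2, h.1⟩
  choose τ hτlt hτgt using hτ
  have hinner : ∀ i j, inner ℝ (e' - τ j • e) (w i) = inner ℝ e (w i) * (σ i - τ j) := by
    intro i j
    rw [← hws i, inner_sub_left, real_inner_smul_left]
    have := (hVpos _ (hwV i)).ne'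
    simp only [hs]
    field_simp
  refine ⟨V.card, fun i => if h : i - 1 < V.card then w ⟨i - 1, h⟩ else 0,
    fun j => if h : j - 1 < V.card then e' - τ ⟨j - 1, h⟩ • e else 0, he, fun i hi0 hiM => ?_⟩
  have hi : i - 1 < V.card := by omega
  simp only [dif_pos hi]
  refine ⟨hVU _ (hwV _), fun j hj0 hjM => ?_⟩
  have hj : j - 1 < V.card := by omega
  rw [dif_pos hj, hinner]
  have hpos := hVpos _ (hwV ⟨i - 1, hi⟩)
  by_cases hij : j ≤ i
  · have hle : σ ⟨j - 1, hj⟩ ≤ σ ⟨i - 1, hi⟩ := σ.monotone (by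
      rw [Fin.mk_le_mk]
      omega)
    have h1 := hτlt ⟨j - 1, hj⟩
    have h2 := mul_pos hpos (sub_pos.2 (h1.trans_le hle))
    exact ⟨h2.ne', iff_of_true h2 hij⟩
  · have h1 := hτgt ⟨j - 1, hj⟩ ⟨i - 1, hi⟩ (by
      rw [Fin.mk_lt_mk]
      omega)
    have h2 := mul_neg_of_pos_of_neg hpos (sub_neg.2 h1)
    exact ⟨h2.ne, iff_of_false h2.le.not_gt hij⟩

/-! ### Tools from integration theory -/

/-- The Riemann-Lebesgue lemma along a ray of frequencies. -/
theorem tendsto_integral_mul_fourierChar {W : EuclideanSpace ℝ (Fin n) → ℂ}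
    {ξ : EuclideanSpace ℝ (Fin n)} (hξ : ξ ≠ 0) :
    Tendsto (fun l : ℝ => ∫ x, W x * (Real.fourierChar (inner ℝ (l • ξ) x) : ℂ)) atTop (𝓝 0) := by
  have h := tendsto_integral_exp_inner_smul_cocompact W
  have hc : Tendsto (fun l : ℝ => -(l • ξ)) atTop (cocompact (EuclideanSpace ℝ (Fin n))) := by
    rw [← Metric.cobounded_eq_cocompact, ← tendsto_norm_atTop_iff_cobounded]
    simp only [norm_neg, norm_smul]
    exact tendsto_norm_atTop_atTop.atTop_mul_const (norm_pos_iff.2 hξ)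
  refine (h.comp hc).congr fun l => ?_
  simp only [Function.comp]
  congr 1 with x
  rw [inner_neg_right, neg_neg, real_inner_comm, Circle.smul_def, smul_eq_mul, mul_comm]

theorem exists_schwartz_eLpNorm_sub_le {p : ℝ≥0∞} (hp1 : 1 ≤ p) (hp : p ≠ ⊤)
    {A : Set (EuclideanSpace ℝ (Fin n))} (hA : MeasurableSet A) (hAf : volume A ≠ ⊤)
    {ε : ℝ≥0∞} (hε : ε ≠ 0) :
    ∃ a : 𝓢(EuclideanSpace ℝ (Fin n), ℂ),
      eLpNorm (fun x => a x - A.indicator (fun _ => 1) x) p volume ≤ ε := by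
  lift p to ℝ≥0 using hp
  have : Fact (1 ≤ (p : ℝ≥0∞)) := ⟨hp1⟩
  have hmem : MemLp (A.indicator fun _ => (1 : ℂ)) p volume :=
    memLp_indicator_const _ hA _ (Or.inr hAf)
  have hd := SchwartzMap.denseRange_toLpCLM (E := EuclideanSpace ℝ (Fin n)) (F := ℂ) (p := p)
    ENNReal.coe_ne_top (μ := volume)
  obtain ⟨a, ha⟩ := hd.exists_mem_open (Metric.isOpen_eball (x := hmem.toLp) (ε := ε))
    ⟨hmem.toLp, Metric.mem_eball_self (pos_iff_ne_zero.2 hε)⟩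
  refine ⟨a, le_trans (le_of_eq ?_) (Metric.mem_eball.1 ha).le⟩
  rw [SchwartzMap.toLpCLM_apply, SchwartzMap.toLp, Lp.edist_toLp_toLp]
  rfl

/-! ### Triangular families of operators -/

/-- A family of additive operators `S i`, `i < N`, on Schwartz functions is triangular with respect
to the frequencies `ξ j`, `0 < j < N`, if `S i` asymptotically keeps functions modulated by a high
multiple of `ξ j` for `j ≤ i`, and kills them for `i < j`. The operator `S 0` thus plays the role
of an empty partial sum. -/
structure IsTriangular (N : ℕ)
    (S : ℕ → 𝓢(EuclideanSpace ℝ (Fin n), ℂ) → EuclideanSpace ℝ (Fin n) → ℂ)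
    (ξ : ℕ → EuclideanSpace ℝ (Fin n)) : Prop where
  add : ∀ i f g, S i (f + g) = S i f + S i g
  continuous : ∀ i f, Continuous (S i f)
  ne_zero : ∀ j ∈ Finset.Ico 1 N, ξ j ≠ 0
  asymptotic : ∀ i < N, ∀ j ∈ Finset.Ico 1 N, ∀ a : 𝓢(EuclideanSpace ℝ (Fin n), ℂ), ∀ δ : ℝ,
    0 < δ → ∀ᶠ l : ℝ in atTop, ∀ x,
      ‖S i (modulate (l • ξ j) a) x - (if j ≤ i then modulate (l • ξ j) a x else 0)‖ ≤ δ

theorem IsTriangular.add_sum {N : ℕ}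
    {S : ℕ → 𝓢(EuclideanSpace ℝ (Fin n), ℂ) → EuclideanSpace ℝ (Fin n) → ℂ}
    {ξ : ℕ → EuclideanSpace ℝ (Fin n)} (h : IsTriangular N S ξ) (i : ℕ)
    (f : 𝓢(EuclideanSpace ℝ (Fin n), ℂ)) (s : Finset ℕ)
    (b : ℕ → 𝓢(EuclideanSpace ℝ (Fin n), ℂ)) (x : EuclideanSpace ℝ (Fin n)) :
    S i (f + ∑ j ∈ s, b j) x = S i f x + ∑ j ∈ s, S i (b j) x := by
  let A : 𝓢(EuclideanSpace ℝ (Fin n), ℂ) →+ (EuclideanSpace ℝ (Fin n) → ℂ) :=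
    AddMonoidHom.mk' (S i) (h.add i)
  have := congrFun (show A (f + ∑ j ∈ s, b j) = A f + ∑ j ∈ s, A (b j) by
    rw [map_add, map_sum]) x
  simpa [A] using this

/-! ### Wave packets with a variable direction -/

section Packet

/-- The function `x ↦ e^{2πi l ξ_{j(x)}⬝x}` on `B`, extended by zero. Its frequency depends on
`x` through the index `j x`. -/
noncomputable def packet (B : Set (EuclideanSpace ℝ (Fin n))) (ξ : ℕ → EuclideanSpace ℝ (Fin n))
    (j : EuclideanSpace ℝ (Fin n) → ℕ) (l : ℝ) (x : EuclideanSpace ℝ (Fin n)) : ℂ :=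
  B.indicator (fun x => (Real.fourierChar (inner ℝ (l • ξ (j x)) x) : ℂ)) x

variable {B : Set (EuclideanSpace ℝ (Fin n))} {ξ : ℕ → EuclideanSpace ℝ (Fin n)}
  {j : EuclideanSpace ℝ (Fin n) → ℕ} {N : ℕ}

theorem norm_packet_le (l : ℝ) (x : EuclideanSpace ℝ (Fin n)) : ‖packet B ξ j l x‖ ≤ 1 :=
  (norm_indicator_le_norm_self _ _).trans_eq (Circle.norm_coe _)

theorem packet_of_mem {x : EuclideanSpace ℝ (Fin n)} (hx : x ∈ B) (l : ℝ) :
    packet B ξ j l x = (Real.fourierChar (inner ℝ (l • ξ (j x)) x) : ℂ) :=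
  Set.indicator_of_mem hx _

theorem packet_of_notMem {x : EuclideanSpace ℝ (Fin n)} (hx : x ∉ B) (l : ℝ) :
    packet B ξ j l x = 0 :=
  Set.indicator_of_notMem hx _

theorem packet_sq (l : ℝ) (x : EuclideanSpace ℝ (Fin n)) :
    packet B ξ j l x ^ 2 = packet B ξ j (l * 2) x := by
  by_cases hx : x ∈ B
  · have h : inner ℝ ((l * 2) • ξ (j x)) x = inner ℝ (l • ξ (j x)) x + inner ℝ (l • ξ (j x)) x := by
      simp only [real_inner_smul_left]
      ring
    rw [packet_of_mem hx, packet_of_mem hx, h, AddChar.map_add_eq_mul, Circle.coe_mul, sq]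
  · simp [packet_of_notMem hx]

/-- The piece of `B` on which the index is `i`. -/
def piece (B : Set (EuclideanSpace ℝ (Fin n))) (j : EuclideanSpace ℝ (Fin n) → ℕ) (i : ℕ) :
    Set (EuclideanSpace ℝ (Fin n)) :=
  B ∩ j ⁻¹' {i}

theorem measurableSet_piece (hB : MeasurableSet B) (hj : Measurable j) (i : ℕ) :
    MeasurableSet (piece B j i) :=
  hB.inter (hj (measurableSet_singleton i))

theorem sum_piece_ite (hj : ∀ x, j x ∈ Finset.Ico 1 N) (P : ℕ → Prop) [DecidablePred P]
    (l : ℝ) (x : EuclideanSpace ℝ (Fin n)) :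
    (if P (j x) then packet B ξ j l x else 0) = ∑ i ∈ Finset.Ico 1 N,
      if P i then (piece B j i).indicator (fun _ => (1 : ℂ)) x *
        (Real.fourierChar (inner ℝ (l • ξ i) x) : ℂ) else 0 := by
  rw [Finset.sum_eq_single_of_mem (j x) (hj x)]
  · by_cases hx : x ∈ B
    · rw [packet_of_mem hx, Set.indicator_of_mem (show x ∈ piece B j (j x) from ⟨hx, rfl⟩), one_mul]
    · rw [packet_of_notMem hx, Set.indicator_of_notMem (fun h => hx h.1), zero_mul]
  · intro i _ hi
    rw [Set.indicator_of_notMem (fun h => hi h.2.symm), zero_mul, ite_self]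

theorem packet_eq_sum (hj : ∀ x, j x ∈ Finset.Ico 1 N) (l : ℝ) (x : EuclideanSpace ℝ (Fin n)) :
    packet B ξ j l x = ∑ i ∈ Finset.Ico 1 N, (piece B j i).indicator (fun _ => (1 : ℂ)) x *
        (Real.fourierChar (inner ℝ (l • ξ i) x) : ℂ) := by
  simpa using sum_piece_ite (B := B) (ξ := ξ) hj (fun _ => True) l x

theorem continuous_wave (η : EuclideanSpace ℝ (Fin n)) :
    Continuous fun x => (Real.fourierChar (inner ℝ η x) : ℂ) :=
  continuous_subtype_val.comp (Real.continuous_fourierChar.comp (by fun_prop))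

theorem measurable_packet (hB : MeasurableSet B) (hjm : Measurable j)
    (hj : ∀ x, j x ∈ Finset.Ico 1 N) (l : ℝ) : Measurable (packet B ξ j l) := by
  rw [funext (packet_eq_sum hj l)]
  exact Finset.measurable_fun_sum _ fun i _ =>
    (measurable_const.indicator (measurableSet_piece hB hjm i)).mul (continuous_wave _).measurable

/-- Wave packets oscillate: they become orthogonal to every integrable function as the frequency
increases. -/
theorem tendsto_integral_mul_packet (hB : MeasurableSet B) (hjm : Measurable j)
    (hj : ∀ x, j x ∈ Finset.Ico 1 N) (hξ : ∀ i ∈ Finset.Ico 1 N, ξ i ≠ 0)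
    {W : EuclideanSpace ℝ (Fin n) → ℂ} (hW : IntegrableOn W B) :
    Tendsto (fun l : ℝ => ∫ x in B, W x * packet B ξ j l x) atTop (𝓝 0) := by
  have h0 : Tendsto (fun l : ℝ => ∑ i ∈ Finset.Ico 1 N, ∫ x, (piece B j i).indicator W x *
      (Real.fourierChar (inner ℝ (l • ξ i) x) : ℂ)) atTop (𝓝 (∑ i ∈ Finset.Ico 1 N, 0)) :=
    tendsto_finsetSum _ fun i hi => tendsto_integral_mul_fourierChar (hξ i hi)
  rw [Finset.sum_const_zero] at h0
  refine h0.congr fun l => ?_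
  rw [← integral_finsetSum, ← integral_indicator hB]
  · congr 1 with x
    by_cases hx : x ∈ B
    · rw [Set.indicator_of_mem hx, packet_eq_sum hj, Finset.mul_sum]
      refine Finset.sum_congr rfl fun i _ => ?_
      by_cases hi : x ∈ piece B j i <;> simp [hi]
    · rw [Set.indicator_of_notMem hx]
      refine Finset.sum_eq_zero fun i _ => ?_
      rw [Set.indicator_of_notMem (fun h => hx h.1), zero_mul]
  · intro i _
    have hi : Integrable ((piece B j i).indicator W) := by
      rw [integrable_indicator_iff (measurableSet_piece hB hjm i)]
      exact hW.mono_set Set.inter_subset_left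
    exact hi.mul_bdd (c := 1) (continuous_wave _).aestronglyMeasurable
      (Eventually.of_forall fun x => (Circle.norm_coe _).le)

theorem integrableOn_packet (hB : MeasurableSet B) (hBf : volume B ≠ ⊤) (hjm : Measurable j)
    (hj : ∀ x, j x ∈ Finset.Ico 1 N) (l : ℝ) : IntegrableOn (packet B ξ j l) B := by
  have : Fact (volume B < ⊤) := ⟨hBf.lt_top⟩
  exact Integrable.of_bound (measurable_packet hB hjm hj l).aestronglyMeasurable 1
    (Eventually.of_forall fun x => norm_packet_le l x)

/-- Adding a wave packet of high frequency to `G` hardly increases the exponential moments of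
`G`, by `e^s ≤ 1 + s + s²` for `|s| ≤ 1`. -/
theorem eventually_integral_exp_le (hB : MeasurableSet B) (hBf : volume B ≠ ⊤) (hB0 : volume B ≠ 0)
    (hjm : Measurable j) (hj : ∀ x, j x ∈ Finset.Ico 1 N) (hξ : ∀ i ∈ Finset.Ico 1 N, ξ i ≠ 0)
    {G : EuclideanSpace ℝ (Fin n) → ℂ} (hG : Measurable G) {C : ℝ} (hGC : ∀ x, ‖G x‖ ≤ C)
    {t : ℝ} (ht : 0 < t) (ht1 : t ≤ 1) {u : ℂ} (hu : ‖u‖ = 1) :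
    ∀ᶠ l : ℝ in atTop, ∫ x in B, Real.exp (t * (u * (G x + packet B ξ j l x)).re) ≤
      (1 + 2 * t ^ 2) * ∫ x in B, Real.exp (t * (u * G x).re) := by
  have : Fact (volume B < ⊤) := ⟨hBf.lt_top⟩
  have hbound : ∀ {D : ℝ} {z : ℂ}, ‖z‖ ≤ D → ‖Real.exp (t * (u * z).re)‖ ≤ Real.exp D := by
    intro D z hz
    rw [Real.norm_eq_abs, Real.abs_exp, Real.exp_le_exp]
    have h1 : |(u * z).re| ≤ D := by
      refine (Complex.abs_re_le_norm _).trans ?_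
      rwa [norm_mul, hu, one_mul]
    have h2 := (abs_le.1 h1).2
    have h3 := (abs_nonneg _).trans h1
    nlinarith
  have hW : IntegrableOn (fun x => Real.exp (t * (u * G x).re)) B :=
    Integrable.of_bound (Measurable.aestronglyMeasurable (by fun_prop)) (Real.exp C)
      (Eventually.of_forall fun x => hbound (hGC x))
  set W : EuclideanSpace ℝ (Fin n) → ℝ := fun x => Real.exp (t * (u * G x).re) with hWdef
  have hWpos : 0 < ∫ x in B, W x := by
    have : NeZero (volume.restrict B) := ⟨by simpa using hB0⟩
    exact integral_exp_pos hW
  have hlim := tendsto_integral_mul_packet (ξ := ξ) hB hjm hj hξ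
    (W := fun x => (W x : ℂ) * u) (hW.ofReal.mul_const u)
  have hre := (Complex.continuous_re.tendsto _).comp hlim
  have hsmall : 0 < t * ∫ x in B, W x := by positivity
  filter_upwards [hre.eventually (gt_mem_nhds (by simpa using hsmall))] with l hl
  have hgi := integrableOn_packet (ξ := ξ) hB hBf hjm hj l
  have hWg : IntegrableOn (fun x => (W x : ℂ) * u * packet B ξ j l x) B :=
    (hW.ofReal.mul_const u).mul_bdd (c := 1) hgi.aestronglyMeasurable
      (Eventually.of_forall fun x => norm_packet_le l x)
  simp only [Function.comp] at hl
  have hint : (∫ x in B, (W x : ℂ) * u * packet B ξ j l x).re =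
      ∫ x in B, W x * (u * packet B ξ j l x).re := by
    rw [← Complex.reCLM_apply, ← ContinuousLinearMap.integral_comp_comm _ hWg]
    congr 1 with x
    rw [mul_assoc, Complex.reCLM_apply, Complex.re_ofReal_mul]
  rw [hint] at hl
  have hWr : IntegrableOn (fun x => W x * (u * packet B ξ j l x).re) B := by
    refine hWg.re.congr (Eventually.of_forall fun x => ?_)
    simp only [mul_assoc]
    exact Complex.re_ofReal_mul _ _
  calc ∫ x in B, Real.exp (t * (u * (G x + packet B ξ j l x)).re)
      ≤ ∫ x in B, ((1 + t ^ 2) * W x + t * (W x * (u * packet B ξ j l x).re)) := by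
        refine integral_mono ?_ ((hW.const_mul _).add (hWr.const_mul _)) fun x => ?_
        · have := measurable_packet (ξ := ξ) hB hjm hj l
          refine Integrable.of_bound (Measurable.aestronglyMeasurable (by fun_prop))
            (Real.exp (C + 1)) (Eventually.of_forall fun x => hbound ?_)
          exact (norm_add_le _ _).trans (add_le_add (hGC x) (norm_packet_le l x))
        · simp only
          rw [mul_add, Complex.add_re, mul_add, Real.exp_add]
          have h1 : |(u * packet B ξ j l x).re| ≤ 1 := by
            refine (Complex.abs_re_le_norm _).trans ?_
            rw [norm_mul, hu, one_mul]
            exact norm_packet_le l x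
          set s := (u * packet B ξ j l x).re
          have h2 : |t * s| ≤ 1 := by
            rw [abs_mul, abs_of_pos ht]
            exact mul_le_one₀ ht1 (abs_nonneg _) h1
          have h3 := (abs_le.1 (Real.abs_exp_sub_one_sub_id_le h2)).2
          have h4 : (t * s) ^ 2 ≤ t ^ 2 := by
            rw [mul_pow]
            exact mul_le_of_le_one_right (sq_nonneg t) ((sq_le_one_iff_abs_le_one s).2 h1)
          have h5 : 0 < W x := Real.exp_pos _
          have h6 : Real.exp (t * s) ≤ 1 + t ^ 2 + t * s := by linarith
          calc W x * Real.exp (t * s) ≤ W x * (1 + t ^ 2 + t * s) := by gcongr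
            _ = _ := by ring
    _ = (1 + t ^ 2) * (∫ x in B, W x) + t * ∫ x in B, W x * (u * packet B ξ j l x).re := by
        rw [integral_add (hW.const_mul _) (hWr.const_mul _), integral_const_mul, integral_const_mul]
    _ ≤ (1 + 2 * t ^ 2) * ∫ x in B, W x := by nlinarith

/-- The positive part of the real part of a wave packet of high frequency has large mean, by
`s⁺ ≥ (s² + s) / 2` for `|s| ≤ 1`. -/
theorem eventually_le_integral_max (hB : MeasurableSet B) (hB1 : volume B = 1)
    (hjm : Measurable j) (hj : ∀ x, j x ∈ Finset.Ico 1 N) (hξ : ∀ i ∈ Finset.Ico 1 N, ξ i ≠ 0) :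
    ∀ᶠ l : ℝ in atTop, 1 / 8 ≤ ∫ x in B, max (packet B ξ j l x).re 0 := by
  have hBf : volume B ≠ ⊤ := by simp [hB1]
  have : Fact (volume B < ⊤) := ⟨hBf.lt_top⟩
  have hlim : Tendsto (fun l : ℝ => ∫ x in B, packet B ξ j l x) atTop (𝓝 0) := by
    simpa using tendsto_integral_mul_packet (ξ := ξ) hB hjm hj hξ (W := fun _ => 1)
      (integrable_const _)
  have hre : Tendsto (fun l : ℝ => (∫ x in B, packet B ξ j l x).re) atTop (𝓝 0) := by
    simpa [Function.comp_def] using (Complex.continuous_re.tendsto _).comp hlim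
  have hre2 : Tendsto (fun l : ℝ => (∫ x in B, packet B ξ j (l * 2) x).re) atTop (𝓝 0) :=
    hre.comp (tendsto_id.atTop_mul_const zero_lt_two)
  filter_upwards [hre.eventually (lt_mem_nhds (show (-1 / 8 : ℝ) < 0 by norm_num)),
    hre2.eventually (lt_mem_nhds (show (-1 / 8 : ℝ) < 0 by norm_num))] with l h1 h2
  have hg := integrableOn_packet (ξ := ξ) hB hBf hjm hj l
  have hg2 := integrableOn_packet (ξ := ξ) hB hBf hjm hj (l * 2)
  have e1 : (∫ x in B, packet B ξ j l x).re = ∫ x in B, (packet B ξ j l x).re :=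
    (integral_re hg).symm
  have e2 : (∫ x in B, packet B ξ j (l * 2) x).re = ∫ x in B, (packet B ξ j (l * 2) x).re :=
    (integral_re hg2).symm
  have i1 : IntegrableOn (fun x => (packet B ξ j l x).re) B := hg.re
  have i2 : IntegrableOn (fun x => (packet B ξ j (l * 2) x).re) B := hg2.re
  have i3 : IntegrableOn (fun x => 1 / 4 * (packet B ξ j (l * 2) x).re +
      1 / 2 * (packet B ξ j l x).re) B := (i2.const_mul _).add (i1.const_mul _)
  have hsum : ∫ x in B, (1 / 4 + (1 / 4 * (packet B ξ j (l * 2) x).re +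
      1 / 2 * (packet B ξ j l x).re)) =
      1 / 4 + (1 / 4 * (∫ x in B, (packet B ξ j (l * 2) x).re) +
        1 / 2 * ∫ x in B, (packet B ξ j l x).re) := by
    rw [integral_add (integrable_const _) i3,
      integral_add (i2.const_mul _) (i1.const_mul _), integral_const_mul, integral_const_mul]
    simp [Measure.real, hB1]
  have hmono : ∫ x in B, (1 / 4 + (1 / 4 * (packet B ξ j (l * 2) x).re +
      1 / 2 * (packet B ξ j l x).re)) ≤ ∫ x in B, max (packet B ξ j l x).re 0 := by
    refine setIntegral_mono_on ((integrable_const _).add i3)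
      i1.pos_part hB fun x hx => ?_
    rw [← packet_sq]
    have hn : (packet B ξ j l x).re ^ 2 + (packet B ξ j l x).im ^ 2 = 1 := by
      have : Complex.normSq (packet B ξ j l x) = 1 := by
        rw [Complex.normSq_eq_norm_sq, packet_of_mem hx, Circle.norm_coe, one_pow]
      rw [Complex.normSq_apply] at this
      linarith
    set z := packet B ξ j l x
    have hsq : (z ^ 2).re = 2 * z.re ^ 2 - 1 := by
      rw [sq, Complex.mul_re]
      linarith
    rw [hsq]
    rcases le_total 0 z.re with h | h
    · rw [max_eq_left h]
      nlinarith [sq_nonneg z.im]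
    · rw [max_eq_right h]
      nlinarith [sq_nonneg z.im]
  rw [e1] at h1
  rw [e2] at h2
  linarith

end Packet

/-! ### Construction of the extremal function -/

/-- The state of the construction of an extremal function after `d` of `k` steps, on a set `B`
of measure one. The Schwartz function `f` approximates a sum `G` of `d` wave packets, and
`Q i`, which approximates `S i f`, is the sum of those parts of the packets that `S i` keeps.
At a point `x` the indices `i` in the block `[c x, c x + 2 ^ (k - d))` have not been told apart yet,
and for all of them the real part of `Q i x` is `R x`, which has large mean. On the other hand
`G` behaves like a random walk, in that it has the exponential moments of one. -/
structure Stage (p : ℝ≥0∞) (B : Set (EuclideanSpace ℝ (Fin n)))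
    (S : ℕ → 𝓢(EuclideanSpace ℝ (Fin n), ℂ) → EuclideanSpace ℝ (Fin n) → ℂ) (k d : ℕ) (t : ℝ)
    (ε : ℝ≥0∞) (f : 𝓢(EuclideanSpace ℝ (Fin n), ℂ)) (c : EuclideanSpace ℝ (Fin n) → ℕ)
    (G : EuclideanSpace ℝ (Fin n) → ℂ) (R : EuclideanSpace ℝ (Fin n) → ℝ)
    (Q : ℕ → EuclideanSpace ℝ (Fin n) → ℂ) : Prop where
  measurable_c : Measurable c
  measurable_G : Measurable G
  measurable_R : Measurable R
  measurable_Q : ∀ i, Measurable (Q i)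
  c_add_le : ∀ x, c x + 2 ^ (k - d) ≤ 2 ^ k
  norm_G_le : ∀ x, ‖G x‖ ≤ d
  G_eq_zero : ∀ x ∉ B, G x = 0
  abs_R_le : ∀ x, |R x| ≤ d
  re_Q : ∀ x, ∀ i, c x ≤ i → i < c x + 2 ^ (k - d) → (Q i x).re = R x
  eLpNorm_sub_G : eLpNorm (fun x => f x - G x) p volume ≤ ε
  eLpNorm_sub_Q : ∀ i < 2 ^ k, eLpNorm (fun x => S i f x - Q i x) p (volume.restrict B) ≤ ε
  integral_exp_le : ∀ u ∈ ({1, -1, Complex.I, -Complex.I} : Finset ℂ),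
    ∫ x in B, Real.exp (t * (u * G x).re) ≤ (1 + 2 * t ^ 2) ^ d
  le_integral_R : (d : ℝ) / 8 ≤ ∫ x in B, R x

theorem Stage.zero {p : ℝ≥0∞} {B : Set (EuclideanSpace ℝ (Fin n))} (hB1 : volume B = 1) {k : ℕ}
    {S : ℕ → 𝓢(EuclideanSpace ℝ (Fin n), ℂ) → EuclideanSpace ℝ (Fin n) → ℂ}
    {ξ : ℕ → EuclideanSpace ℝ (Fin n)} (hS : IsTriangular (2 ^ k) S ξ) (t : ℝ) (ε : ℝ≥0∞) :
    Stage p B S k 0 t ε 0 0 0 0 0 where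
  measurable_c := measurable_const
  measurable_G := measurable_const
  measurable_R := measurable_const
  measurable_Q _ := measurable_const
  c_add_le := by simp
  norm_G_le := by simp
  G_eq_zero := by simp
  abs_R_le := by simp
  re_Q := by simp
  eLpNorm_sub_G := by simp
  eLpNorm_sub_Q i _ := by
    have h : S i 0 = 0 := by simpa using hS.add i 0 0
    simp [h]
  integral_exp_le u _ := by simp [Measure.real, hB1]
  le_integral_R := by simp

/-- One step of the construction: a wave packet is added whose frequency at `x` belongs to the
middle index `j x` of the block of `x`. Where its real part is positive, `x` moves to the upper half
of its block, for which the packet is kept, otherwise to the lower half, for which it is killed. So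
only positive terms ever enter `R`. -/
theorem Stage.succ {p : ℝ≥0∞} (hp1 : 1 ≤ p) (hp : p ≠ ⊤) {B : Set (EuclideanSpace ℝ (Fin n))}
    (hB : MeasurableSet B) (hB1 : volume B = 1) {k d : ℕ} (hd : d < k)
    {S : ℕ → 𝓢(EuclideanSpace ℝ (Fin n), ℂ) → EuclideanSpace ℝ (Fin n) → ℂ}
    {ξ : ℕ → EuclideanSpace ℝ (Fin n)} (hS : IsTriangular (2 ^ k) S ξ)
    {t : ℝ} (ht : 0 < t) (ht1 : t ≤ 1) {ε : ℝ≥0∞} (hε : ε ≠ 0) (hε' : ε ≠ ⊤)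
    {f : 𝓢(EuclideanSpace ℝ (Fin n), ℂ)} {c : EuclideanSpace ℝ (Fin n) → ℕ}
    {G : EuclideanSpace ℝ (Fin n) → ℂ} {R : EuclideanSpace ℝ (Fin n) → ℝ}
    {Q : ℕ → EuclideanSpace ℝ (Fin n) → ℂ} (h : Stage p B S k d t (ε / 2) f c G R Q) :
    ∃ f c G R Q, Stage p B S k (d + 1) t ε f c G R Q := by
  have hBf : volume B ≠ ⊤ := by simp [hB1]
  have hB0 : volume B ≠ 0 := by simp [hB1]
  have : Fact (volume B < ⊤) := ⟨hBf.lt_top⟩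
  set b := 2 ^ (k - (d + 1)) with hb
  have hb0 : 0 < b := by positivity
  have hb2 : 2 ^ (k - d) = b + b := by
    rw [hb, ← two_mul, ← pow_succ']
    congr 1
    omega
  set N := 2 ^ k with hN
  set j : EuclideanSpace ℝ (Fin n) → ℕ := fun x => c x + b with hjdef
  have hjm : Measurable j := h.measurable_c.add_const b
  have hj : ∀ x, j x ∈ Finset.Ico 1 N := by
    intro x
    have := h.c_add_le x
    rw [hb2] at this
    rw [Finset.mem_Ico]
    simp only [hjdef]
    omega
  have hE := fun i => measurableSet_piece hB hjm i
  -- The errors of the approximations and of the asymptotics add up to at most `ε / 2`.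
  set η : ℝ≥0∞ := ε / 2 / (N * 2 : ℕ) with hη
  have hη0 : η ≠ 0 := (ENNReal.div_pos (ENNReal.half_pos hε).ne' (ENNReal.natCast_ne_top _)).ne'
  have hηt : η ≠ ⊤ := by
    refine (ENNReal.div_lt_top (ENNReal.div_lt_top hε' (by simp)).ne ?_).ne
    simp [hN]
  have hηsum : ∑ _i ∈ Finset.Ico 1 N, (η + η) ≤ ε / 2 := by
    rw [Finset.sum_const, Nat.card_Ico, nsmul_eq_mul, ← two_mul, ← mul_assoc]
    calc ((N - 1 : ℕ) : ℝ≥0∞) * 2 * η ≤ ((N * 2 : ℕ) : ℝ≥0∞) * η := by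
          rw [Nat.cast_mul]
          gcongr
          · exact_mod_cast Nat.sub_le N 1
          · simp
      _ ≤ ε / 2 := ENNReal.mul_div_le
  have hηsum' : ∑ _i ∈ Finset.Ico 1 N, η ≤ ε / 2 :=
    (Finset.sum_le_sum fun _ _ => le_self_add).trans hηsum
  have hEf : ∀ i, volume (piece B j i) ≠ ⊤ := fun i =>
    measure_ne_top_of_subset Set.inter_subset_left hBf
  choose a ha using fun i => exists_schwartz_eLpNorm_sub_le hp1 hp (hE i) (hEf i) hη0
  have hδ : 0 < η.toReal := ENNReal.toReal_pos hη0 hηt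
  have hev1 : ∀ᶠ l : ℝ in atTop, ∀ u ∈ ({1, -1, Complex.I, -Complex.I} : Finset ℂ),
      ∫ x in B, Real.exp (t * (u * (G x + packet B ξ j l x)).re) ≤
        (1 + 2 * t ^ 2) * ∫ x in B, Real.exp (t * (u * G x).re) := by
    rw [Filter.eventually_all_finset]
    intro u hu
    refine eventually_integral_exp_le hB hBf hB0 hjm hj hS.ne_zero h.measurable_G h.norm_G_le ht ht1
      ?_
    simp only [Finset.mem_insert, Finset.mem_singleton] at hu
    rcases hu with rfl | rfl | rfl | rfl <;> simp
  have hev2 : ∀ᶠ l : ℝ in atTop, ∀ i ∈ Finset.range N, ∀ q ∈ Finset.Ico 1 N, ∀ x,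
      ‖S i (modulate (l • ξ q) (a q)) x - (if q ≤ i then modulate (l • ξ q) (a q) x else 0)‖ ≤
        η.toReal := by
    rw [Filter.eventually_all_finset]
    intro i hi
    rw [Filter.eventually_all_finset]
    exact fun q hq => hS.asymptotic i (Finset.mem_range.1 hi) q hq (a q) _ hδ
  obtain ⟨l, hl1, hl2, hl3⟩ := (hev1.and (hev2.and
    (eventually_le_integral_max (ξ := ξ) hB hB1 hjm hj hS.ne_zero))).exists
  set g := packet B ξ j l with hg
  have hgm : Measurable g := measurable_packet hB hjm hj l
  have hg1 : ∀ x, ‖g x‖ ≤ 1 := norm_packet_le l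
  -- The part of the new packet with index `q` and its Schwartz approximation.
  set e : ℕ → EuclideanSpace ℝ (Fin n) → ℂ := fun q x => modulate (l • ξ q) (a q) x -
    (piece B j q).indicator (fun _ => (1 : ℂ)) x * (Real.fourierChar (inner ℝ (l • ξ q) x) : ℂ)
    with he
  have hem : ∀ q, Measurable (e q) := fun q => (modulate (l • ξ q) (a q)).continuous.measurable.sub
    ((measurable_const.indicator (hE q)).mul (continuous_wave _).measurable)
  have heη : ∀ q, eLpNorm (e q) p volume ≤ η := by
    intro q
    refine le_trans (eLpNorm_mono fun x => le_of_eq ?_) (ha q)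
    simp only [he]
    rw [modulate_apply, mul_comm ((piece B j q).indicator _ x), ← mul_sub, norm_mul,
      Circle.norm_coe, one_mul]
  have hsum_le : ∀ (μ : Measure (EuclideanSpace ℝ (Fin n))) (F : EuclideanSpace ℝ (Fin n) → ℂ)
      (D : ℕ → EuclideanSpace ℝ (Fin n) → ℂ) (θ : ℝ≥0∞), Measurable F → (∀ q, Measurable (D q)) →
      eLpNorm F p μ ≤ ε / 2 → (∀ q ∈ Finset.Ico 1 N, eLpNorm (D q) p μ ≤ θ) →
      ∑ _i ∈ Finset.Ico 1 N, θ ≤ ε / 2 →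
      eLpNorm (fun x => F x + ∑ q ∈ Finset.Ico 1 N, D q x) p μ ≤ ε := by
    intro μ F D θ hF hD hF' hD' hθ
    have hDs : (fun x => ∑ q ∈ Finset.Ico 1 N, D q x) = ∑ q ∈ Finset.Ico 1 N, D q := by
      ext x
      simp
    calc eLpNorm (fun x => F x + ∑ q ∈ Finset.Ico 1 N, D q x) p μ
        ≤ eLpNorm F p μ + eLpNorm (fun x => ∑ q ∈ Finset.Ico 1 N, D q x) p μ :=
          eLpNorm_add_le hF.aestronglyMeasurable
            (Finset.measurable_fun_sum _ fun q _ => hD q).aestronglyMeasurable hp1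
      _ ≤ ε / 2 + ∑ q ∈ Finset.Ico 1 N, eLpNorm (D q) p μ := by
          rw [hDs]
          exact add_le_add hF' (eLpNorm_sum_le (fun q _ => (hD q).aestronglyMeasurable) hp1)
      _ ≤ ε / 2 + ε / 2 := by
          gcongr
          exact (Finset.sum_le_sum hD').trans hθ
      _ = ε := ENNReal.add_halves ε
  refine ⟨f + ∑ q ∈ Finset.Ico 1 N, modulate (l • ξ q) (a q),
    fun x => if 0 < (g x).re then j x else c x, fun x => G x + g x,
    fun x => R x + max (g x).re 0, fun i x => Q i x + if j x ≤ i then g x else 0, ?_⟩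
  constructor
  · exact Measurable.ite (measurableSet_lt measurable_const (by fun_prop)) hjm h.measurable_c
  · exact h.measurable_G.add hgm
  · have := h.measurable_R
    fun_prop
  · intro i
    exact (h.measurable_Q i).add
      (Measurable.ite (measurableSet_le hjm measurable_const) hgm measurable_const)
  · intro x
    have := h.c_add_le x
    rw [hb2] at this
    simp only [hjdef]
    split_ifs <;> omega
  · intro x
    push_cast
    exact (norm_add_le _ _).trans (add_le_add (h.norm_G_le x) (hg1 x))
  · intro x hx
    rw [h.G_eq_zero x hx, hg, packet_of_notMem hx, add_zero]
  · intro x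
    push_cast
    refine (abs_add_le _ _).trans (add_le_add (h.abs_R_le x) ?_)
    rw [abs_of_nonneg (le_max_right _ _)]
    exact max_le ((Complex.re_le_norm _).trans (hg1 x)) zero_le_one
  · intro x i hi1 hi2
    have hQ := h.re_Q x i
    rw [hb2] at hQ
    rw [← hb] at hi2
    rw [Complex.add_re]
    by_cases hpos : 0 < (g x).re
    · rw [if_pos hpos] at hi1 hi2
      simp only [hjdef] at hi1 hi2
      rw [hQ (by omega) (by omega), if_pos (by simpa only [hjdef] using hi1), max_eq_left hpos.le]
    · rw [if_neg hpos] at hi1 hi2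
      rw [hQ (by omega) (by omega), if_neg (by simp only [hjdef]; omega),
        max_eq_right (not_lt.1 hpos), Complex.zero_re]
  · have hrw : ∀ x, (f + ∑ q ∈ Finset.Ico 1 N, modulate (l • ξ q) (a q)) x - (G x + g x) =
        (f x - G x) + ∑ q ∈ Finset.Ico 1 N, e q x := by
      intro x
      have hgx : g x = _ := packet_eq_sum hj l x
      rw [hgx, _root_.add_apply, _root_.sum_apply]
      simp only [he, Finset.sum_sub_distrib]
      ring
    simp only [hrw]
    exact hsum_le volume _ _ η (f.continuous.measurable.sub h.measurable_G) hem h.eLpNorm_sub_G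
      (fun q _ => heη q) hηsum'
  · intro i hi
    have hrw : ∀ x, S i (f + ∑ q ∈ Finset.Ico 1 N, modulate (l • ξ q) (a q)) x -
        (Q i x + if j x ≤ i then g x else 0) = (S i f x - Q i x) + ∑ q ∈ Finset.Ico 1 N,
          ((S i (modulate (l • ξ q) (a q)) x -
            (if q ≤ i then modulate (l • ξ q) (a q) x else 0)) + (if q ≤ i then e q x else 0)) := by
      intro x
      have hgx : (if j x ≤ i then g x else 0) = _ :=
        sum_piece_ite (B := B) (ξ := ξ) hj (fun q => q ≤ i) l x
      rw [hgx, hS.add_sum, add_sub_add_comm, ← Finset.sum_sub_distrib]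
      congr 1
      refine Finset.sum_congr rfl fun q _ => ?_
      simp only [he]
      split_ifs <;> ring
    simp only [hrw]
    have hm1 : ∀ q, Measurable fun x => S i (modulate (l • ξ q) (a q)) x -
        (if q ≤ i then modulate (l • ξ q) (a q) x else 0) := by
      intro q
      refine (hS.continuous i _).measurable.sub ?_
      split_ifs
      · exact (modulate (l • ξ q) (a q)).continuous.measurable
      · exact measurable_const
    have hm2 : ∀ q, Measurable fun x => if q ≤ i then e q x else 0 := by
      intro q
      split_ifs
      · exact hem q
      · exact measurable_const
    refine hsum_le _ _ _ (η + η) ((hS.continuous i f).measurable.sub (h.measurable_Q i))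
      (fun q => (hm1 q).add (hm2 q)) (h.eLpNorm_sub_Q i hi) (fun q hq => ?_) hηsum
    refine (eLpNorm_add_le (hm1 q).aestronglyMeasurable (hm2 q).aestronglyMeasurable hp1).trans
      (add_le_add ?_ ?_)
    · refine (eLpNorm_le_of_ae_bound
        (Eventually.of_forall (hl2 i (Finset.mem_range.2 hi) q hq))).trans ?_
      simp [hB1, ENNReal.ofReal_toReal hηt]
    · refine le_trans ?_ (heη q)
      refine (eLpNorm_mono fun x => ?_).trans (eLpNorm_mono_measure _ Measure.restrict_le_self)
      split_ifs <;> simp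
  · intro u hu
    refine (hl1 u hu).trans ?_
    rw [pow_succ' (1 + 2 * t ^ 2) d]
    exact mul_le_mul_of_nonneg_left (h.integral_exp_le u hu) (by positivity)
  · have hRi : IntegrableOn R B := Integrable.of_bound h.measurable_R.aestronglyMeasurable d
      (Eventually.of_forall h.abs_R_le)
    have hgi : IntegrableOn (fun x => max (g x).re 0) B :=
      (integrableOn_packet hB hBf hjm hj l).re.pos_part
    rw [integral_add hRi hgi]
    have := h.le_integral_R
    push_cast
    linarith

theorem exists_stage {p : ℝ≥0∞} (hp1 : 1 ≤ p) (hp : p ≠ ⊤) {B : Set (EuclideanSpace ℝ (Fin n))}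
    (hB : MeasurableSet B) (hB1 : volume B = 1) {k : ℕ}
    {S : ℕ → 𝓢(EuclideanSpace ℝ (Fin n), ℂ) → EuclideanSpace ℝ (Fin n) → ℂ}
    {ξ : ℕ → EuclideanSpace ℝ (Fin n)} (hS : IsTriangular (2 ^ k) S ξ)
    {t : ℝ} (ht : 0 < t) (ht1 : t ≤ 1) (d : ℕ) (hd : d ≤ k) :
    ∀ ε : ℝ≥0∞, ε ≠ 0 → ε ≠ ⊤ → ∃ f c G R Q, Stage p B S k d t ε f c G R Q := by
  induction d with
  | zero => exact fun ε _ _ => ⟨_, _, _, _, _, Stage.zero hB1 hS t ε⟩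
  | succ d ih =>
    intro ε hε hε'
    obtain ⟨f, c, G, R, Q, h⟩ := ih (by omega) (ε / 2) (ENNReal.half_pos hε).ne'
      (ENNReal.div_lt_top hε' (by simp)).ne
    exact h.succ hp1 hp hB hB1 (by omega) hS ht ht1 hε hε'

/-! ### From exponential moments to norms -/

theorem rpow_le_factorial_mul_exp {p s : ℝ} (hp : 0 ≤ p) (hs : 0 ≤ s) :
    s ^ p ≤ (1 + (⌈p⌉₊.factorial : ℝ)) * Real.exp s := by
  have h1 : 1 ≤ Real.exp s := Real.one_le_exp hs
  have hf : (0 : ℝ) < ⌈p⌉₊.factorial := by exact_mod_cast Nat.factorial_pos _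
  rcases le_total s 1 with h | h
  · have := Real.rpow_le_one hs h hp
    nlinarith
  · have h2 : s ^ p ≤ s ^ ⌈p⌉₊ := by
      rw [← Real.rpow_natCast]
      exact Real.rpow_le_rpow_of_exponent_le h (Nat.le_ceil p)
    have h3 := Real.pow_div_factorial_le_exp s hs ⌈p⌉₊
    rw [div_le_iff₀ hf] at h3
    nlinarith

theorem norm_rpow_le_sum_exp {p : ℝ} (hp : 0 ≤ p) (z : ℂ) :
    ‖z‖ ^ p ≤ 2 ^ p * (1 + (⌈p⌉₊.factorial : ℝ)) *
      ∑ u ∈ ({1, -1, Complex.I, -Complex.I} : Finset ℂ), Real.exp (u * z).re := by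
  set s := max |z.re| |z.im| with hs
  have hs0 : 0 ≤ s := (abs_nonneg _).trans (le_max_left _ _)
  have hz : ‖z‖ ≤ 2 * s := by
    refine (Complex.norm_le_abs_re_add_abs_im z).trans ?_
    rw [two_mul]
    exact add_le_add (le_max_left _ _) (le_max_right _ _)
  obtain ⟨u, hu, hus⟩ : ∃ u ∈ ({1, -1, Complex.I, -Complex.I} : Finset ℂ), (u * z).re = s := by
    rcases max_choice |z.re| |z.im| with h | h <;> rw [hs, h]
    · rcases abs_choice z.re with h' | h' <;> rw [h']
      · exact ⟨1, by simp, by simp⟩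
      · exact ⟨-1, by simp, by simp⟩
    · rcases abs_choice z.im with h' | h' <;> rw [h']
      · exact ⟨-Complex.I, by simp, by simp⟩
      · exact ⟨Complex.I, by simp, by simp⟩
  calc ‖z‖ ^ p ≤ (2 * s) ^ p := Real.rpow_le_rpow (norm_nonneg _) hz hp
    _ = 2 ^ p * s ^ p := Real.mul_rpow zero_le_two hs0
    _ ≤ 2 ^ p * ((1 + (⌈p⌉₊.factorial : ℝ)) * Real.exp s) := by
        gcongr
        exact rpow_le_factorial_mul_exp hp hs0
    _ = 2 ^ p * (1 + (⌈p⌉₊.factorial : ℝ)) * Real.exp (u * z).re := by rw [hus, mul_assoc]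
    _ ≤ _ := by
        gcongr
        exact Finset.single_le_sum (f := fun u => Real.exp (u * z).re)
          (fun _ _ => (Real.exp_pos _).le) hu

/-- Exponential moments at scale `t` bound the `L^p` norm by a multiple of `1 / t`. -/
theorem eLpNorm_le_of_integral_exp_le {p : ℝ} (hp : 1 < p)
    {B : Set (EuclideanSpace ℝ (Fin n))} (hB : MeasurableSet B) (hBf : volume B ≠ ⊤)
    {G : EuclideanSpace ℝ (Fin n) → ℂ} (hG : Measurable G) (hG0 : ∀ x ∉ B, G x = 0) {C : ℝ}
    (hGC : ∀ x, ‖G x‖ ≤ C) {t D : ℝ} (ht : 0 < t)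
    (hexp : ∀ u ∈ ({1, -1, Complex.I, -Complex.I} : Finset ℂ),
      ∫ x in B, Real.exp (t * (u * G x).re) ≤ D) :
    eLpNorm G (ENNReal.ofReal p) volume ≤
      ENNReal.ofReal ((2 ^ p * (1 + (⌈p⌉₊.factorial : ℝ)) *
        ((({1, -1, Complex.I, -Complex.I} : Finset ℂ).card : ℝ) * D)) ^ p⁻¹ / t) := by
  have : Fact (volume B < ⊤) := ⟨hBf.lt_top⟩
  have hp0 : 0 < p := zero_lt_one.trans hp
  have hind : B.indicator G = G := Set.indicator_eq_self.2 fun x hx => by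
    by_contra h
    exact hx (hG0 x h)
  rw [← hind, eLpNorm_indicator_eq_eLpNorm_restrict hB]
  have hmem : MemLp (fun x => (t : ℂ) * G x) (ENNReal.ofReal p) (volume.restrict B) := by
    refine MemLp.of_bound (Measurable.aestronglyMeasurable (by fun_prop)) (t * C)
      (Eventually.of_forall fun x => ?_)
    rw [norm_mul, Complex.norm_real, Real.norm_of_nonneg ht.le]
    exact mul_le_mul_of_nonneg_left (hGC x) ht.le
  have hpow : ∫ x in B, ‖(t : ℂ) * G x‖ ^ p ≤ 2 ^ p * (1 + (⌈p⌉₊.factorial : ℝ)) *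
      ((({1, -1, Complex.I, -Complex.I} : Finset ℂ).card : ℝ) * D) := by
    have hre : ∀ (u : ℂ) x, (u * (t * G x)).re = t * (u * G x).re := by
      intro u x
      rw [mul_left_comm, Complex.re_ofReal_mul]
    have hint : ∀ u ∈ ({1, -1, Complex.I, -Complex.I} : Finset ℂ),
        IntegrableOn (fun x => Real.exp (t * (u * G x).re)) B := by
      intro u _
      refine Integrable.of_bound (Measurable.aestronglyMeasurable (by fun_prop))
        (Real.exp (t * (‖u‖ * C))) (Eventually.of_forall fun x => ?_)
      rw [Real.norm_eq_abs, Real.abs_exp, Real.exp_le_exp]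
      refine mul_le_mul_of_nonneg_left ((Complex.re_le_norm _).trans ?_) ht.le
      rw [norm_mul]
      exact mul_le_mul_of_nonneg_left (hGC x) (norm_nonneg _)
    calc ∫ x in B, ‖(t : ℂ) * G x‖ ^ p
        ≤ ∫ x in B, 2 ^ p * (1 + (⌈p⌉₊.factorial : ℝ)) *
          ∑ u ∈ ({1, -1, Complex.I, -Complex.I} : Finset ℂ), Real.exp (t * (u * G x).re) := by
          refine integral_mono_of_nonneg (Eventually.of_forall fun x => by positivity)
            ((integrable_finsetSum _ hint).const_mul _) (Eventually.of_forall fun x => ?_)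
          have := norm_rpow_le_sum_exp hp0.le ((t : ℂ) * G x)
          simpa only [hre] using this
      _ ≤ _ := by
          rw [integral_const_mul, integral_finsetSum _ hint, ← nsmul_eq_mul]
          gcongr
          exact Finset.sum_le_card_nsmul _ _ _ hexp
  have hnorm := hmem.eLpNorm_eq_integral_rpow_norm (by simpa using hp0) ENNReal.ofReal_ne_top
  rw [ENNReal.toReal_ofReal hp0.le] at hnorm
  have hGt : eLpNorm G (ENNReal.ofReal p) (volume.restrict B) =
      ENNReal.ofReal t⁻¹ *
        eLpNorm (fun x => (t : ℂ) * G x) (ENNReal.ofReal p) (volume.restrict B) := by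
    have h := eLpNorm_const_smul (t : ℂ) G (ENNReal.ofReal p) (volume.restrict B)
    have h2 : ‖(t : ℂ)‖ₑ = ENNReal.ofReal t := by
      rw [← ofReal_norm, Complex.norm_real, Real.norm_of_nonneg ht.le]
    rw [h2] at h
    change _ = _ * eLpNorm ((t : ℂ) • G) _ _
    rw [h, ← mul_assoc, ← ENNReal.ofReal_mul (inv_nonneg.2 ht.le), inv_mul_cancel₀ ht.ne',
      ENNReal.ofReal_one, one_mul]
  rw [hGt, hnorm, ← ENNReal.ofReal_mul (inv_nonneg.2 ht.le), div_eq_inv_mul]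
  have hnn : 0 ≤ ∫ x in B, ‖(t : ℂ) * G x‖ ^ p := integral_nonneg fun x => by positivity
  gcongr

theorem exists_measurableSet_volume_eq_one :
    ∃ B : Set (EuclideanSpace ℝ (Fin n)), MeasurableSet B ∧ volume B = 1 := by
  let b := EuclideanSpace.basisFun (Fin n) ℝ
  refine ⟨parallelepiped b, ?_, b.volume_parallelepiped⟩
  have := b.toBasis.parallelepiped.isCompact.measurableSet
  simpa using this

/-! ### The lower bound for triangular families -/

/-- The maximal function of a triangular family of `2 ^ k` operators has norm at least of order
`√k` on `L^p`: for the function built in `exists_stage` it is at least of order `k` in the mean,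
while the function itself has norm of order `√k`. -/
theorem exists_le_of_isTriangular {p : ℝ} (hp : 1 < p) :
    ∃ C : ℝ, 0 < C ∧ ∀ (n k : ℕ), 1 ≤ k →
      ∀ (S : ℕ → 𝓢(EuclideanSpace ℝ (Fin n), ℂ) → EuclideanSpace ℝ (Fin n) → ℂ)
        (ξ : ℕ → EuclideanSpace ℝ (Fin n)), IsTriangular (2 ^ k) S ξ → ∀ K : ℝ≥0∞,
        (∀ f : 𝓢(EuclideanSpace ℝ (Fin n), ℂ), ∃ m : EuclideanSpace ℝ (Fin n) → ℝ,
          (∀ i < 2 ^ k, ∀ x, ‖S i f x‖ ≤ m x) ∧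
          eLpNorm m (ENNReal.ofReal p) volume ≤ K * eLpNorm f (ENNReal.ofReal p) volume) →
        ENNReal.ofReal (C * √k) ≤ K := by
  set A : ℝ := (2 ^ p * (1 + (⌈p⌉₊.factorial : ℝ)) *
    ((({1, -1, Complex.I, -Complex.I} : Finset ℂ).card : ℝ) * Real.exp 2)) ^ p⁻¹ with hA
  have hA0 : 0 ≤ A := by positivity
  refine ⟨1 / (16 * (A + 1)), by positivity, fun n k hk S ξ hS K hK => ?_⟩
  rcases eq_or_ne K ⊤ with rfl | hKt
  · exact le_top
  lift K to ℝ≥0 using hKt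
  have hk0 : (0 : ℝ) < k := by exact_mod_cast hk
  have hk1 : (1 : ℝ) ≤ k := by exact_mod_cast hk
  have hsq : 0 < √(k : ℝ) := Real.sqrt_pos.2 hk0
  have hp1 : 1 ≤ ENNReal.ofReal p := by simpa using hp.le
  obtain ⟨B, hB, hB1⟩ := exists_measurableSet_volume_eq_one (n := n)
  have hprob : IsProbabilityMeasure (volume.restrict B) := ⟨by simpa using hB1⟩
  set t : ℝ := (√(k : ℝ))⁻¹ with ht
  have ht0 : 0 < t := by positivity
  have ht1 : t ≤ 1 := inv_le_one_of_one_le₀ (by simpa using hk1)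
  -- The approximation error: below the norm of `f`, and so small that all `2 ^ k` errors together
  -- take away only half of the mean of `R`.
  set r : ℝ := min (√(k : ℝ)) (k / 16 / 2 ^ k) with hr
  have hr0 : 0 < r := by positivity
  obtain ⟨f, c, G, R, Q, h⟩ := exists_stage hp1 ENNReal.ofReal_ne_top hB hB1 hS ht0 ht1 k le_rfl
    (ENNReal.ofReal r) (ENNReal.ofReal_pos.2 hr0).ne' ENNReal.ofReal_ne_top
  obtain ⟨m, hm, hmK⟩ := hK f
  have hG : eLpNorm G (ENNReal.ofReal p) volume ≤ ENNReal.ofReal (A * √k) := by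
    have hbound : (1 + 2 * t ^ 2) ^ k ≤ Real.exp 2 := by
      calc (1 + 2 * t ^ 2) ^ k ≤ Real.exp (2 * t ^ 2) ^ k := by
            gcongr
            linarith [Real.add_one_le_exp (2 * t ^ 2)]
        _ = Real.exp 2 := by
            rw [← Real.exp_nat_mul, ht, inv_pow, Real.sq_sqrt hk0.le]
            congr 1
            field_simp
    have := eLpNorm_le_of_integral_exp_le hp hB (by simp [hB1]) h.measurable_G h.G_eq_zero
      h.norm_G_le ht0 fun u hu => (h.integral_exp_le u hu).trans hbound
    rwa [← hA, ht, div_inv_eq_mul] at this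
  have hf : eLpNorm f (ENNReal.ofReal p) volume ≤ ENNReal.ofReal ((A + 1) * √k) := by
    have hsplit : (f : EuclideanSpace ℝ (Fin n) → ℂ) = (fun x => f x - G x) + G := by
      ext x
      exact (sub_add_cancel (f x) (G x)).symm
    rw [hsplit]
    refine (eLpNorm_add_le (f.continuous.measurable.sub h.measurable_G).aestronglyMeasurable
      h.measurable_G.aestronglyMeasurable hp1).trans
      ((add_le_add h.eLpNorm_sub_G hG).trans ?_)
    rw [← ENNReal.ofReal_add hr0.le (mul_nonneg hA0 hsq.le)]
    refine ENNReal.ofReal_le_ofReal ?_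
    linarith [min_le_left (√(k : ℝ)) (k / 16 / 2 ^ k)]
  have hR : ENNReal.ofReal (k / 8) ≤ eLpNorm R (ENNReal.ofReal p) (volume.restrict B) := by
    calc ENNReal.ofReal (k / 8) ≤ ENNReal.ofReal (∫ x in B, R x) :=
          ENNReal.ofReal_le_ofReal h.le_integral_R
      _ ≤ ENNReal.ofReal ‖∫ x in B, R x‖ := ENNReal.ofReal_le_ofReal (Real.le_norm_self _)
      _ = ‖∫ x in B, R x‖ₑ := ofReal_norm _
      _ ≤ ∫⁻ x in B, ‖R x‖ₑ := enorm_integral_le_lintegral_enorm _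
      _ = eLpNorm R 1 (volume.restrict B) := eLpNorm_one_eq_lintegral_enorm.symm
      _ ≤ _ := eLpNorm_le_eLpNorm_of_exponent_le hp1 h.measurable_R.aestronglyMeasurable
  set err : ℕ → EuclideanSpace ℝ (Fin n) → ℝ := fun i x => ‖S i f x - Q i x‖ with herr
  have herrm : ∀ i, Measurable (err i) := fun i =>
    ((hS.continuous i f).measurable.sub (h.measurable_Q i)).norm
  have herr_le : ∀ i ∈ Finset.range (2 ^ k),
      eLpNorm (err i) (ENNReal.ofReal p) (volume.restrict B) ≤ ENNReal.ofReal r := by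
    intro i hi
    rw [herr, eLpNorm_norm]
    exact h.eLpNorm_sub_Q i (Finset.mem_range.1 hi)
  have hEm : Measurable fun x => ∑ i ∈ Finset.range (2 ^ k), err i x :=
    Finset.measurable_fun_sum _ fun i _ => herrm i
  have hE : eLpNorm (fun x => ∑ i ∈ Finset.range (2 ^ k), err i x) (ENNReal.ofReal p)
      (volume.restrict B) ≤ ENNReal.ofReal (k / 16) := by
    have hsum : (fun x => ∑ i ∈ Finset.range (2 ^ k), err i x) =
        ∑ i ∈ Finset.range (2 ^ k), err i := by
      ext x
      simp
    rw [hsum]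
    refine (eLpNorm_sum_le (fun i _ => (herrm i).aestronglyMeasurable) hp1).trans
      ((Finset.sum_le_sum herr_le).trans ?_)
    rw [Finset.sum_const, Finset.card_range, ← ENNReal.ofReal_nsmul]
    refine ENNReal.ofReal_le_ofReal ?_
    rw [nsmul_eq_mul, Nat.cast_pow, Nat.cast_ofNat, mul_comm, ← le_div_iff₀ (by positivity)]
    exact min_le_right _ _
  -- A measurable minorant of the majorant `m`, which need not be measurable.
  set m' : EuclideanSpace ℝ (Fin n) → ℝ := fun x =>
    max (|R x| - ∑ i ∈ Finset.range (2 ^ k), err i x) 0 with hm'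
  have hm'm : Measurable m' := by
    have := h.measurable_R
    exact (this.abs.sub hEm).max measurable_const
  have hm'le : ∀ x, ‖m' x‖ ≤ m x := by
    intro x
    rw [Real.norm_of_nonneg (le_max_right _ _)]
    refine max_le ?_ ((norm_nonneg _).trans (hm 0 (by positivity) x))
    have hc := h.c_add_le x
    rw [Nat.sub_self, pow_zero] at hc
    have hc' : c x < 2 ^ k := hc
    have h1 : |R x| ≤ ‖Q (c x) x‖ := by
      rw [← h.re_Q x (c x) le_rfl (by simp)]
      exact Complex.abs_re_le_norm _
    have h2 : ‖Q (c x) x‖ ≤ ‖S (c x) f x‖ + err (c x) x := by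
      simp only [herr]
      rw [norm_sub_rev]
      simpa using norm_add_le (S (c x) f x) (Q (c x) x - S (c x) f x)
    have h3 : err (c x) x ≤ ∑ i ∈ Finset.range (2 ^ k), err i x :=
      Finset.single_le_sum (f := fun i => err i x) (fun _ _ => norm_nonneg _)
        (Finset.mem_range.2 hc')
    linarith [hm (c x) hc' x]
  have hm'K : eLpNorm m' (ENNReal.ofReal p) (volume.restrict B) ≤
      ENNReal.ofReal (K * ((A + 1) * √k)) := by
    calc eLpNorm m' (ENNReal.ofReal p) (volume.restrict B)
        ≤ eLpNorm m' (ENNReal.ofReal p) volume := eLpNorm_mono_measure _ Measure.restrict_le_self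
      _ ≤ eLpNorm m (ENNReal.ofReal p) volume := eLpNorm_mono_real hm'le
      _ ≤ K * ENNReal.ofReal ((A + 1) * √k) := hmK.trans (by gcongr)
      _ = _ := by rw [ENNReal.ofReal_mul K.coe_nonneg, ENNReal.ofReal_coe_nnreal]
  have hfinal : ENNReal.ofReal (k / 8) ≤ ENNReal.ofReal (K * ((A + 1) * √k) + k / 16) := by
    rw [ENNReal.ofReal_add (by positivity) (by positivity)]
    refine hR.trans (le_trans ?_ ((eLpNorm_add_le hm'm.aestronglyMeasurable
      hEm.aestronglyMeasurable hp1).trans (add_le_add hm'K hE)))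
    refine eLpNorm_mono fun x => ?_
    rw [Real.norm_eq_abs, Real.norm_eq_abs]
    refine le_trans ?_ (le_abs_self _)
    simp only [Pi.add_apply, hm']
    linarith [le_max_left (|R x| - ∑ i ∈ Finset.range (2 ^ k), err i x) 0]
  rw [ENNReal.ofReal_le_ofReal_iff (by positivity)] at hfinal
  rw [← ENNReal.ofReal_coe_nnreal]
  refine ENNReal.ofReal_le_ofReal ?_
  have hss : √(k : ℝ) * √k = k := Real.mul_self_sqrt hk0.le
  have h5 : √(k : ℝ) ≤ K * (16 * (A + 1)) := by
    refine le_of_mul_le_mul_right ?_ hsq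
    rw [hss]
    nlinarith
  rw [one_div_mul_eq_div, div_le_iff₀ (by positivity)]
  exact h5

/-! ### Maximal operators of a set of directions -/

theorem norm_le_maximal {T : EuclideanSpace ℝ (Fin n) → 𝓢(EuclideanSpace ℝ (Fin n), ℂ) →
      EuclideanSpace ℝ (Fin n) → ℂ} {U : Finset (EuclideanSpace ℝ (Fin n))}
    {v : EuclideanSpace ℝ (Fin n)} (hv : v ∈ U) (f : 𝓢(EuclideanSpace ℝ (Fin n), ℂ))
    (x : EuclideanSpace ℝ (Fin n)) : ‖T v f x‖ ≤ maximal T U f x := by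
  rw [maximal, ← coe_nnnorm, NNReal.coe_le_coe]
  exact Finset.le_sup (f := fun v => ‖T v f x‖₊) hv

theorem measurable_maximal {T : EuclideanSpace ℝ (Fin n) → 𝓢(EuclideanSpace ℝ (Fin n), ℂ) →
      EuclideanSpace ℝ (Fin n) → ℂ} {U : Finset (EuclideanSpace ℝ (Fin n))}
    {f : 𝓢(EuclideanSpace ℝ (Fin n), ℂ)} (h : ∀ v ∈ U, Continuous (T v f)) :
    Measurable (maximal T U f) :=
  (NNReal.continuous_coe.comp
    (Continuous.finset_sup_apply fun v hv => (h v hv).nnnorm)).measurable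

theorem continuous_hilbert {v : EuclideanSpace ℝ (Fin n)} (hv : ‖v‖ = 1)
    (f : 𝓢(EuclideanSpace ℝ (Fin n), ℂ)) : Continuous (hilbert v f) := by
  rw [funext (hilbert_eq v hv f)]
  exact continuous_const.mul
    ((continuous_const.mul (continuous_halfSpaceMultiplier v f)).sub f.continuous)

theorem norm_halfSpaceMultiplier_le {v : EuclideanSpace ℝ (Fin n)} (hv : ‖v‖ = 1)
    (f : 𝓢(EuclideanSpace ℝ (Fin n), ℂ)) (x : EuclideanSpace ℝ (Fin n)) :
    ‖halfSpaceMultiplier v f x‖ ≤ 2⁻¹ * (‖f x‖ + ‖hilbert v f x‖) := by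
  have h : halfSpaceMultiplier v f x = 2⁻¹ * (f x + Complex.I * hilbert v f x) := by
    rw [hilbert_eq v hv]
    linear_combination ((2 * halfSpaceMultiplier v f x - f x) / 2) * Complex.I_sq
  rw [h, norm_mul, norm_inv, Complex.norm_ofNat]
  refine mul_le_mul_of_nonneg_left ((norm_add_le _ _).trans_eq ?_) (by norm_num)
  rw [norm_mul, Complex.norm_I, one_mul]

/-- Every majorant of the half-space multipliers with directions in `U` has norm at least of order
`√(log #U)`. -/
theorem exists_le_of_norm_halfSpaceMultiplier_le {p : ℝ} (hp : 1 < p) :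
    ∃ C : ℝ, 0 < C ∧ ∀ (n : ℕ) (U : Finset (EuclideanSpace ℝ (Fin n))), (∀ v ∈ U, ‖v‖ = 1) →
      ∀ K : ℝ≥0∞, (∀ f : 𝓢(EuclideanSpace ℝ (Fin n), ℂ), ∃ m : EuclideanSpace ℝ (Fin n) → ℝ,
        (∀ x, 0 ≤ m x) ∧ (∀ v ∈ U, ∀ x, ‖halfSpaceMultiplier v f x‖ ≤ m x) ∧
        eLpNorm m (ENNReal.ofReal p) volume ≤ K * eLpNorm f (ENNReal.ofReal p) volume) →
      ENNReal.ofReal (C * √(Real.logb 2 U.card)) ≤ K := by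
  obtain ⟨C, hC, h⟩ := exists_le_of_isTriangular hp
  refine ⟨C / 2, by positivity, fun n U hU K hK => ?_⟩
  by_cases hcard : U.card ≤ 1
  · have h0 : Real.logb 2 (U.card : ℝ) = 0 := by
      interval_cases U.card <;> simp
    simp [h0]
  obtain ⟨M, w, ξ, hM, hw⟩ := exists_triangular_directions U hU
  set k := Nat.log 2 (M + 1) with hk
  have hk1 : 1 ≤ k := Nat.log_pos one_lt_two (by omega)
  have hkM : 2 ^ k ≤ M + 1 := Nat.pow_log_le_self 2 (by omega)
  have hMk : M + 1 < 2 ^ (k + 1) := Nat.lt_pow_succ_log_self one_lt_two _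
  have htri : IsTriangular (2 ^ k) (fun i => if i = 0 then 0 else halfSpaceMultiplier (w i)) ξ := by
    refine ⟨fun i f g => ?_, fun i f => ?_, fun j hj => ?_, fun i hi j hj a δ hδ => ?_⟩
    · split_ifs
      · simp
      · exact halfSpaceMultiplier_add _ _ _
    · split_ifs
      · exact continuous_const
      · exact continuous_halfSpaceMultiplier _ _
    · rw [Finset.mem_Ico] at hj
      have := ((hw j (by omega) (by omega)).2 j (by omega) (by omega)).1
      rintro h0
      simp [h0] at this
    · rw [Finset.mem_Ico] at hj
      by_cases hi0 : i = 0
      · refine Eventually.of_forall fun l x => ?_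
        rw [if_pos hi0, if_neg (by omega)]
        simpa using hδ.le
      · obtain ⟨h1, h2⟩ := (hw i (by omega) (by omega)).2 j (by omega) (by omega)
        simp only [if_neg hi0, ← h2]
        exact halfSpaceMultiplier_modulate _ _ h1 a hδ
  have hbound := h n k hk1 _ ξ htri K fun f => by
    obtain ⟨m, hm0, hm, hmK⟩ := hK f
    refine ⟨m, fun i hi x => ?_, hmK⟩
    by_cases hi0 : i = 0
    · simpa [hi0] using hm0 x
    · simp only [if_neg hi0]
      exact hm _ (hw i (by omega) (by omega)).1 x
  refine le_trans (ENNReal.ofReal_le_ofReal ?_) hbound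
  -- `#U ≤ 2 M < 2 ^ (k + 2) ≤ 2 ^ (4 k)`.
  have hlog : Real.logb 2 (U.card : ℝ) ≤ 2 ^ 2 * k := by
    have hU0 : (0 : ℝ) < U.card := by exact_mod_cast (by omega : 0 < U.card)
    rw [Real.logb_le_iff_le_rpow one_lt_two hU0]
    have hnat : U.card ≤ 2 ^ (2 ^ 2 * k) := by
      calc U.card ≤ 2 ^ (k + 2) := by
            rw [pow_succ]
            omega
        _ ≤ 2 ^ (2 ^ 2 * k) := Nat.pow_le_pow_right two_pos (by omega)
    calc (U.card : ℝ) ≤ ((2 ^ (2 ^ 2 * k) : ℕ) : ℝ) := by exact_mod_cast hnat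
      _ = (2 : ℝ) ^ ((2 : ℝ) ^ 2 * (k : ℝ)) := by
        rw [Nat.cast_pow, ← Real.rpow_natCast]
        norm_num
  have hsq : √(Real.logb 2 (U.card : ℝ)) ≤ 2 * √(k : ℝ) := by
    refine (Real.sqrt_le_sqrt hlog).trans_eq ?_
    rw [Real.sqrt_mul (by positivity), Real.sqrt_sq zero_le_two]
  nlinarith

/-- The norm of the maximal directional Hilbert transform is bounded below. -/
theorem exists_le_of_norm_hilbert_le {p : ℝ} (hp : 1 < p) :
    ∃ C : ℝ, 0 < C ∧ ∀ (n : ℕ) (v : EuclideanSpace ℝ (Fin n)), ‖v‖ = 1 → ∀ K : ℝ≥0∞,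
      (∀ f : 𝓢(EuclideanSpace ℝ (Fin n), ℂ), ∃ m : EuclideanSpace ℝ (Fin n) → ℝ,
        (∀ x, ‖hilbert v f x‖ ≤ m x) ∧
        eLpNorm m (ENNReal.ofReal p) volume ≤ K * eLpNorm f (ENNReal.ofReal p) volume) →
      ENNReal.ofReal C ≤ K := by
  obtain ⟨C, hC, h⟩ := exists_le_of_isTriangular hp
  refine ⟨C, hC, fun n v hv K hK => ?_⟩
  have hv0 : v ≠ 0 := by
    rintro rfl
    simp at hv
  -- `i H_v` keeps functions of high frequency `l v`, as `i H_v f = 2 T_v f - f`.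
  have hI : ∀ f x, Complex.I * hilbert v f x = 2 * halfSpaceMultiplier v f x - f x := by
    intro f x
    rw [hilbert_eq v hv]
    linear_combination (-(2 * halfSpaceMultiplier v f x - f x)) * Complex.I_sq
  have htri : IsTriangular (2 ^ 1)
      (fun i f x => if i = 0 then 0 else Complex.I * hilbert v f x) (fun _ => v) := by
    refine ⟨fun i f g => ?_, fun i f => ?_, fun _ _ => hv0, fun i hi j hj a δ hδ => ?_⟩
    · ext x
      by_cases hi : i = 0
      · simp [hi]
      · simp only [if_neg hi, hI, Pi.add_apply, halfSpaceMultiplier_add, _root_.add_apply]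
        ring
    · split_ifs
      · exact continuous_const
      · exact continuous_const.mul (continuous_hilbert hv f)
    · rw [Finset.mem_Ico] at hj
      by_cases hi0 : i = 0
      · refine Eventually.of_forall fun l x => ?_
        rw [if_pos hi0, if_neg (by omega)]
        simpa using hδ.le
      · have hpos : 0 < inner ℝ v v := by simp [hv]
        filter_upwards [halfSpaceMultiplier_modulate v v hpos.ne' a (half_pos hδ)] with l hl x
        have hx := hl x
        rw [if_pos hpos] at hx
        rw [if_neg hi0, if_pos (by omega), hI, show ∀ z y : ℂ, 2 * z - y - y = 2 * (z - y) by
          intro z y; ring, norm_mul, Complex.norm_ofNat]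
        linarith
  simpa using h n 1 le_rfl _ _ htri K fun f => by
    obtain ⟨m, hm, hmK⟩ := hK f
    refine ⟨m, fun i _ x => ?_, hmK⟩
    by_cases hi0 : i = 0
    · simpa [hi0] using (norm_nonneg _).trans (hm x)
    · simpa [hi0] using hm x

end DirectionalHilbert


theorem theorem1 (n : ℕ) (hn : 2 ≤ n) (p : ℝ) (hp : 1 < p) :
    ∃ C : ℝ, 0 < C ∧
      ∀ U : Finset (EuclideanSpace ℝ (Fin n)), U.Nonempty → (∀ v ∈ U, ‖v‖ = 1) →
        ENNReal.ofReal (C * √(Real.logb 2 (U.card : ℝ))) ≤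
            DirectionalHilbert.opNorm p
              (DirectionalHilbert.maximal DirectionalHilbert.hilbert U) ∧
          ENNReal.ofReal (C * √(Real.logb 2 (U.card : ℝ))) ≤
            DirectionalHilbert.opNorm p
              (DirectionalHilbert.maximal DirectionalHilbert.halfSpaceMultiplier U) := by
  obtain ⟨C₁, hC₁, h₁⟩ := DirectionalHilbert.exists_le_of_norm_halfSpaceMultiplier_le hp
  obtain ⟨C₂, hC₂, h₂⟩ := DirectionalHilbert.exists_le_of_norm_hilbert_le hp
  have hp1 : 1 ≤ ENNReal.ofReal p := by simpa using hp.le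
  refine ⟨min C₁ (2 * C₁ * C₂ / (1 + C₂)), by positivity, fun U hU hU1 => ⟨?_, ?_⟩⟩
  · refine le_sInf fun K hK => ?_
    rcases eq_or_ne K ⊤ with rfl | hKt
    · exact le_top
    have hT := h₁ n U hU1 (2⁻¹ * (1 + K)) fun f => by
      refine ⟨fun x => 2⁻¹ * (‖f x‖ + DirectionalHilbert.maximal DirectionalHilbert.hilbert U f x),
        fun x => ?_, fun v hv x => ?_, ?_⟩
      · have : 0 ≤ DirectionalHilbert.maximal DirectionalHilbert.hilbert U f x := NNReal.coe_nonneg _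
        positivity
      · refine (DirectionalHilbert.norm_halfSpaceMultiplier_le (hU1 v hv) f x).trans ?_
        exact mul_le_mul_of_nonneg_left
          (add_le_add le_rfl (DirectionalHilbert.norm_le_maximal hv f x)) (by norm_num)
      · have hsmul := eLpNorm_const_smul (2⁻¹ : ℝ) (fun x => ‖f x‖ +
          DirectionalHilbert.maximal DirectionalHilbert.hilbert U f x) (ENNReal.ofReal p) volume
        have h2 : ‖(2⁻¹ : ℝ)‖ₑ = 2⁻¹ := by
          rw [← ofReal_norm, Real.norm_of_nonneg (by norm_num),
            ENNReal.ofReal_inv_of_pos two_pos, ENNReal.ofReal_ofNat]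
        rw [h2] at hsmul
        refine hsmul.le.trans ?_
        rw [mul_assoc (2⁻¹ : ℝ≥0∞)]
        refine mul_le_mul_of_nonneg_left ?_ zero_le
        refine (eLpNorm_add_le f.continuous.norm.measurable.aestronglyMeasurable
          (DirectionalHilbert.measurable_maximal fun v hv =>
            DirectionalHilbert.continuous_hilbert (hU1 v hv) f).aestronglyMeasurable hp1).trans ?_
        rw [add_mul, one_mul, eLpNorm_norm]
        gcongr
        exact hK f
    obtain ⟨v, hv⟩ := hU
    have hH := h₂ n v (hU1 v hv) K fun f =>
      ⟨_, DirectionalHilbert.norm_le_maximal hv f, hK f⟩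
    lift K to ℝ≥0 using hKt
    set s := √(Real.logb 2 (U.card : ℝ)) with hs
    have hs0 : 0 ≤ s := Real.sqrt_nonneg _
    have hT' : C₁ * s ≤ 2⁻¹ * (1 + K) := by
      have h2 : (2⁻¹ * (1 + K) : ℝ≥0∞) = ENNReal.ofReal (2⁻¹ * (1 + K)) := by
        rw [ENNReal.ofReal_mul (by norm_num), ENNReal.ofReal_add zero_le_one K.coe_nonneg,
          ENNReal.ofReal_inv_of_pos two_pos, ENNReal.ofReal_ofNat, ENNReal.ofReal_one,
          ENNReal.ofReal_coe_nnreal]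
      rw [h2] at hT
      exact (ENNReal.ofReal_le_ofReal_iff (by positivity)).1 hT
    rw [← ENNReal.ofReal_coe_nnreal] at hH ⊢
    have hH' : C₂ ≤ K := (ENNReal.ofReal_le_ofReal_iff K.coe_nonneg).1 hH
    refine ENNReal.ofReal_le_ofReal ?_
    calc min C₁ (2 * C₁ * C₂ / (1 + C₂)) * s ≤ 2 * C₁ * C₂ / (1 + C₂) * s := by
          gcongr
          exact min_le_right _ _
      _ ≤ K := by
          rw [div_mul_eq_mul_div, div_le_iff₀ (by positivity)]
          nlinarith
  · refine le_sInf fun K hK => ?_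
    refine le_trans (ENNReal.ofReal_le_ofReal ?_) (h₁ n U hU1 K fun f =>
      ⟨_, fun x => NNReal.coe_nonneg _, fun v hv x =>
        DirectionalHilbert.norm_le_maximal hv f x, hK f⟩)
    gcongr
    exact min_le_left _ _
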